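/- Let $N\ge 1$. A region is a nonempty connected open subset of $\mathbb R^N$, and $|\cdot|$ is Lebesgue measure. For a region $\Omega$ put $Q_\Omega(f)=\int_\Omega|\nabla f|^2\,dx$ if $f\in W^{1,2}(\Omega)$ and $Q_\Omega(f)=+\infty$ if $f\in L^2(\Omega)\setminus W^{1,2}(\Omega)$, let $H_\Omega=-\Delta_N\ge 0$ be the Neumann Laplacian, i.e. the self-adjoint operator in $L^2(\Omega)$ associated with $Q_\Omega$, and for integers $n\ge 0$ let $$\mu_n(\Omega)=\inf_{\dim L=n+1}\ \sup_{0\ne f\in L}\frac{Q_\Omega(f)}{\|f\|_{L^2(\Omega)}^2},$$ where $L$ runs over the $(n+1)$-dimensional subspaces of $L^2(\Omega)$. For $\varepsilon>0$ let $\partial_\varepsilon\Omega=\{x\in\Omega:\operatorname{dist}(x,\partial\Omega)\le\varepsilon\}$, and if $|\Omega|<\infty$ let $$M(\partial\Omega)=\inf\Big\{s>0:\ \limsup_{\varepsilon\to0+}\frac{|\partial_\varepsilon\Omega|}{\varepsilon^{N-s}}<\infty\Big\}.$$ Let $\Omega_1\subset\mathbb R^N$ be a region of finite measure such that, for some $q\in(2,\infty]$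 and $c>0$, $\|f\|_{L^q(\Omega_1)}\le c\,\|f\|_{W^{1,2}(\Omega_1)}$ for all $f\in W^{1,2}(\Omega_1)$. Then $H_{\Omega_1}$ has discrete spectrum; let $\lambda_{0,1}\le\lambda_{1,1}\le\dots\to\infty$ be its eigenvalues, repeated according to multiplicity. 1. For every integer $n\ge1$ there exist $b_{n,1},\varepsilon_{n,1}>0$, depending only on $n$ and $\Omega_1$, such that for all regions $\Omega_2\subset\Omega_1$ with $|\Omega_1\setminus\Omega_2|\le\varepsilon_{n,1}$, $$\mu_n(\Omega_2)\le(1+b_{n,1}|\Omega_1\setminus\Omega_2|)\,\lambda_{n,1}.$$ 2. If, in addition, $M(\partial\Omega_1)<N$, then for every $\sigma\in(0,N-M(\partial\Omega_1))$ and every integer $n\ge1$ there exist $b_{n,2},\varepsilon_{n,2}>0$, depending only on $n$, $\sigma$ and $\Omega_1$, such that for all $0<\varepsilon\le\varepsilon_{n,2}$ and all regions $\Omega_2$ with $\Omega_1\setminus\partial_\varepsilon\Omega_1\subset\Omega_2\subset\Omega_1$, $$\mu_n(\Omega_2)\le(1+b_{n,2}\,\varepsilon^\sigma)\,\lambda_{n,1}.$$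 -/

import Mathlib

open MeasureTheory Set Filter Topology
open scoped ENNReal ContDiff InnerProductSpace

noncomputable section

/-- A region in `ℝ^N`: a nonempty connected open set. -/
def IsRegion {N : ℕ} (Ω : Set (EuclideanSpace ℝ (Fin N))) : Prop :=
  IsOpen Ω ∧ IsConnected Ω

/-- The Hilbert space `L²(Ω)` of (classes of) real functions. -/
abbrev L2 {N : ℕ} (Ω : Set (EuclideanSpace ℝ (Fin N))) : Type :=
  Lp ℝ 2 (volume.restrict Ω)

/-- The Hilbert space `L²(Ω; ℝ^N)` of (classes of) square integrable vector fields. -/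
abbrev L2Field {N : ℕ} (Ω : Set (EuclideanSpace ℝ (Fin N))) : Type :=
  Lp (EuclideanSpace ℝ (Fin N)) 2 (volume.restrict Ω)

/-- `φ` is a test function on `Ω`, that is, `φ ∈ C_c^∞(Ω)`. -/
def IsTestFunction {N : ℕ} (Ω : Set (EuclideanSpace ℝ (Fin N)))
    (φ : EuclideanSpace ℝ (Fin N) → ℝ) : Prop :=
  ContDiff ℝ ∞ φ ∧ HasCompactSupport φ ∧ tsupport φ ⊆ Ω

/-- `F = ∇f` weakly in `Ω`, with `f` and `∇f` in `L²`. -/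
def IsWeakGradient {N : ℕ} {Ω : Set (EuclideanSpace ℝ (Fin N))}
    (f : L2 Ω) (F : L2Field Ω) : Prop :=
  ∀ φ : EuclideanSpace ℝ (Fin N) → ℝ, IsTestFunction Ω φ →
    ∀ v : EuclideanSpace ℝ (Fin N),
      ∫ x in Ω, f x * fderiv ℝ φ x v = - ∫ x in Ω, ⟪F x, v⟫_ℝ * φ x

/-- A weak gradient in an open set is unique. -/
theorem IsWeakGradient.unique {N : ℕ} {Ω : Set (EuclideanSpace ℝ (Fin N))} (hΩ : IsOpen Ω)
    {f : L2 Ω} {F G : L2Field Ω} (hF : IsWeakGradient f F) (hG : IsWeakGradient f G) : F = G := by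
  have key : ∀ φ, IsTestFunction Ω φ → MemLp φ 2 (volume.restrict Ω) := fun φ h =>
    (h.1.continuous.memLp_of_hasCompactSupport h.2.1)
  have hL : ∀ F : L2Field Ω, ∀ φ, IsTestFunction Ω φ → Integrable (fun x => φ x • F x) (volume.restrict Ω) :=
    fun F φ h => memLp_one_iff_integrable.1 ((Lp.memLp F).smul (r := 1) (key φ h))
  have h0 : ∀ᵐ x ∂volume, x ∈ Ω → (F x - G x) = 0 := by
    apply hΩ.ae_eq_zero_of_integral_contDiff_smul_eq_zero
    · refine LocallyIntegrableOn.sub ?_ ?_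
      · exact (locallyIntegrableOn_of_locallyIntegrable_restrict ((Lp.memLp F).locallyIntegrable (by norm_num)))
      · exact (locallyIntegrableOn_of_locallyIntegrable_restrict ((Lp.memLp G).locallyIntegrable (by norm_num)))
    · intro φ h1 h2 h3
      have ht : IsTestFunction Ω φ := ⟨h1, h2, h3⟩
      have e : ∫ x, φ x • (F x - G x) = ∫ x in Ω, φ x • (F x - G x) := by
        symm
        apply setIntegral_eq_integral_of_forall_compl_eq_zero
        intro x hx
        have : φ x = 0 := by
          by_contra h
          exact hx (h3 (subset_tsupport _ h))
        simp [this]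
      rw [e]
      simp_rw [smul_sub]
      rw [integral_sub (hL F φ ht) (hL G φ ht), sub_eq_zero]
      refine ext_inner_right ℝ fun v => ?_
      have a1 := hF φ ht v
      have a2 := hG φ ht v
      have t : ∀ F : L2Field Ω, ⟪∫ x in Ω, φ x • F x, v⟫_ℝ = ∫ x in Ω, ⟪F x, v⟫_ℝ * φ x := by
        intro F
        rw [real_inner_comm, ← integral_inner (hL F φ ht)]
        congr 1; ext x
        rw [real_inner_comm, real_inner_smul_left, mul_comm]
      rw [t, t]; linarith
  apply Lp.ext
  rw [Filter.EventuallyEq, ae_restrict_iff' hΩ.measurableSet]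
  filter_upwards [h0] with x hx hxΩ using sub_eq_zero.1 (hx hxΩ)

/-- `f ∈ W^{1,2}(Ω)`. -/
def MemW12 {N : ℕ} {Ω : Set (EuclideanSpace ℝ (Fin N))} (f : L2 Ω) : Prop :=
  ∃ F : L2Field Ω, IsWeakGradient f F

/-- The quadratic form `Q(f) = ∫_Ω |∇f|²` for `f ∈ W^{1,2}(Ω)`, and `Q(f) = +∞` otherwise.
The weak gradient is unique as an element of `L²(Ω; ℝ^N)`, so the infimum is
over at most one field; it is `+∞` when there is none. -/
def Qform {N : ℕ} {Ω : Set (EuclideanSpace ℝ (Fin N))} (f : L2 Ω) : ℝ≥0∞ :=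
  ⨅ (F : L2Field Ω) (_ : IsWeakGradient f F), ∫⁻ x in Ω, ‖F x‖ₑ ^ 2

/-- The norm `‖f‖_{W^{1,2}(Ω)} = (∫_Ω |f|² + ∫_Ω |∇f|²)^{1/2}` (`+∞` off `W^{1,2}(Ω)`). -/
def normW12 {N : ℕ} {Ω : Set (EuclideanSpace ℝ (Fin N))} (f : L2 Ω) : ℝ≥0∞ :=
  (‖f‖ₑ ^ 2 + Qform f) ^ (1 / 2 : ℝ)

/-- The Sobolev inequality `‖f‖_{L^q(Ω)} ≤ c ‖f‖_{W^{1,2}(Ω)}` for all `f ∈ W^{1,2}(Ω)`. -/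
def SobolevInequality {N : ℕ} (Ω : Set (EuclideanSpace ℝ (Fin N))) (q : ℝ≥0∞) (c : ℝ) : Prop :=
  ∀ f : L2 Ω, MemW12 f →
    eLpNorm f q (volume.restrict Ω) ≤ ENNReal.ofReal c * normW12 f

/-- `f ∈ Dom(H)` and `H f = h`, where `H = -Δ_N ≥ 0` is the Neumann Laplacian of `Ω`, the
self-adjoint operator in `L²(Ω)` associated with the form `Q`: it means that `f ∈ W^{1,2}(Ω)`
and `∫_Ω ∇f · ∇g = ∫_Ω h g` for all `g ∈ W^{1,2}(Ω)`. -/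
def HasNeumannLaplacian {N : ℕ} {Ω : Set (EuclideanSpace ℝ (Fin N))} (f h : L2 Ω) : Prop :=
  ∃ F : L2Field Ω, IsWeakGradient f F ∧
    ∀ (g : L2 Ω) (G : L2Field Ω), IsWeakGradient g G →
      ∫ x in Ω, ⟪F x, G x⟫_ℝ = ∫ x in Ω, h x * g x

/-- `H` has discrete spectrum, and `lam 0 ≤ lam 1 ≤ …` are all its eigenvalues, repeated
according to multiplicity: there is a complete orthonormal system of `L²(Ω)` of eigenvectors
`φ n` with eigenvalues `lam n`, and `lam n → ∞` (so that all multiplicities are finite). -/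
def IsNeumannEigenvalueSequence {N : ℕ} (Ω : Set (EuclideanSpace ℝ (Fin N)))
    (lam : ℕ → ℝ) : Prop :=
  Monotone lam ∧ Tendsto lam atTop atTop ∧
    ∃ φ : HilbertBasis ℕ ℝ (L2 Ω), ∀ n, HasNeumannLaplacian (φ n) (lam n • φ n)

/-- `μ(L) = sup {Q(f) / ‖f‖² : 0 ≠ f ∈ L}` for a subspace `L` of `L²(Ω)`. -/
def rayleighSup {N : ℕ} {Ω : Set (EuclideanSpace ℝ (Fin N))} (L : Submodule ℝ (L2 Ω)) : ℝ≥0∞ :=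
  ⨆ (f : L2 Ω) (_ : f ∈ L) (_ : f ≠ 0), Qform f / ‖f‖ₑ ^ 2

/-- The variational quantity `μ_n = inf {μ(L) : dim L = n + 1}`. -/
def variationalEigenvalue {N : ℕ} (Ω : Set (EuclideanSpace ℝ (Fin N))) (n : ℕ) : ℝ≥0∞ :=
  ⨅ (L : Submodule ℝ (L2 Ω)) (_ : Module.finrank ℝ L = n + 1), rayleighSup L

/-- `∂_ε Ω = {x ∈ Ω : d(x) ≤ ε}`, where `d(x)` is the distance from `x` to the boundary. -/
def boundaryLayer {N : ℕ} (Ω : Set (EuclideanSpace ℝ (Fin N))) (ε : ℝ) :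
    Set (EuclideanSpace ℝ (Fin N)) :=
  {x ∈ Ω | Metric.infDist x (frontier Ω) ≤ ε}

/-- `M^s(∂Ω) = limsup_{ε → 0+} |∂_ε Ω| / ε^{N - s}`. -/
def minkowskiContent {N : ℕ} (Ω : Set (EuclideanSpace ℝ (Fin N))) (s : ℝ) : ℝ≥0∞ :=
  limsup (fun ε : ℝ => volume (boundaryLayer Ω ε) / ENNReal.ofReal (ε ^ ((N : ℝ) - s))) (𝓝[>] 0)

/-- The Minkowski dimension `M(∂Ω) = inf {s > 0 : M^s(∂Ω) < ∞}` of `∂Ω` relative to `Ω`. It is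
used for `Ω` of finite measure in `ℝ^N` with `N ≥ 1`, where `s = N` belongs to the set. -/
def minkowskiDim {N : ℕ} (Ω : Set (EuclideanSpace ℝ (Fin N))) : ℝ :=
  sInf {s : ℝ | 0 < s ∧ minkowskiContent Ω s < ⊤}

end

/-!
Restrict the first `n + 1` eigenfunctions `φ₀, …, φₙ` of `Ω₁` to `Ω₂` and use their span as a test
space for `μ_n(Ω₂)`. On `f = ∑ cᵢ φᵢ` the energy over `Ω₂` is at most the energy over `Ω₁`, hence at
most `λ_n ‖f‖²`, and the norm over `Ω₂` is `‖f‖² - ∫_{Ω₁ \ Ω₂} f²`. If the eigenfunctions are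
bounded, then `∫_{Ω₁ \ Ω₂} f² ≤ D |Ω₁ \ Ω₂| ‖f‖²`, so that the Rayleigh quotients are at most
`λ_n / (1 - D |Ω₁ \ Ω₂|)`; this is `variationalEigenvalue_le_of_ae_abs_le`. The bound in terms of
the boundary layer follows because `|∂_ε Ω₁| = O(ε^σ)` for `σ` below the Minkowski codimension
(`exists_measureReal_boundaryLayer_le`).

The Sobolev inequality enters only through its consequence `HasSmallSetBound`: by Hölder,
`∫_A u² ≤ C |A|^θ ‖u‖²_{W^{1,2}}` with `θ > 0`. It gives two things.

* Discrete spectrum. The embedding of `W^{1,2}(Ω₁)` into `L²(Ω₁)` is compact: mass near the boundary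
  is small by the Sobolev inequality, and inside a function whose means over the cubes of a fine grid
  vanish is small by a Poincaré inequality (`exists_finset_norm_sq_le_of_inner_eq_zero`). The
  spectral theorem applied to the resolvent `T T*`, where `T` is the embedding, yields the eigenbasis.
* Bounded eigenfunctions. Testing the equation with truncations of an eigenfunction `f` bounds
  `|{f > l}|` for `l > k` by a power larger than one of `|{f > k}|`, and De Giorgi's iteration shows
  that these sets are null for large levels (`HasNeumannLaplacian.exists_ae_abs_le`).

The calculus of weak gradients which this needs (a Lipschitz bound for translates in `L²`, weak
convergence of difference quotients, and the chain rule for `C^{1,1}` functions) is obtained on all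
of `ℝ^N` by duality with test functions and transferred to `Ω₁` by cutoffs. Truncations are smoothed to
`C^{1,1}` so that this form of the chain rule suffices.
-/

/-! ### Square integrable functions -/

theorem integrable_mul_of_memLp_two {α : Type*} {mα : MeasurableSpace α} {μ : Measure α}
    {f g : α → ℝ} (hf : MemLp f 2 μ) (hg : MemLp g 2 μ) : Integrable (fun x => f x * g x) μ :=
  memLp_one_iff_integrable.1 (hg.mul (r := 1) hf)

theorem integrable_inner_of_memLp_two {α E : Type*} {mα : MeasurableSpace α} {μ : Measure α}
    [NormedAddCommGroup E] [InnerProductSpace ℝ E]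
    {F G : α → E} (hF : MemLp F 2 μ) (hG : MemLp G 2 μ) :
    Integrable (fun x => ⟪F x, G x⟫_ℝ) μ := by
  refine Integrable.mono (integrable_mul_of_memLp_two hF.norm hG.norm)
    (hF.1.inner hG.1) (Eventually.of_forall fun x => ?_)
  simpa using abs_real_inner_le_norm (F x) (G x)

theorem integrable_norm_sq_of_memLp_two {α E : Type*} {mα : MeasurableSpace α} {μ : Measure α}
    [NormedAddCommGroup E] {F : α → E} (hF : MemLp F 2 μ) :
    Integrable (fun x => ‖F x‖ ^ 2) μ := by
  simpa [sq] using integrable_mul_of_memLp_two hF.norm hF.norm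

theorem inner_toLp_eq_integral {α : Type*} {mα : MeasurableSpace α} {μ : Measure α}
    {f g : α → ℝ} (hf : MemLp f 2 μ) (hg : MemLp g 2 μ) :
    ⟪hf.toLp, hg.toLp⟫_ℝ = ∫ x, f x * g x ∂μ := by
  rw [L2.inner_def]
  refine integral_congr_ae ?_
  filter_upwards [hf.coeFn_toLp, hg.coeFn_toLp] with x h1 h2
  rw [h1, h2]; simp [mul_comm]

theorem norm_toLp_sq_eq_integral {α : Type*} {mα : MeasurableSpace α} {μ : Measure α}
    {f : α → ℝ} (hf : MemLp f 2 μ) : ‖hf.toLp‖ ^ 2 = ∫ x, f x ^ 2 ∂μ := by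
  rw [← real_inner_self_eq_norm_sq, inner_toLp_eq_integral]
  simp [sq]

theorem inner_Lp_eq_integral {α : Type*} {mα : MeasurableSpace α} {μ : Measure α}
    (f g : Lp ℝ 2 μ) : ⟪f, g⟫_ℝ = ∫ x, f x * g x ∂μ := by
  rw [L2.inner_def]
  simp [mul_comm]

theorem norm_Lp_sq_eq_integral {α : Type*} {mα : MeasurableSpace α} {μ : Measure α}
    (f : Lp ℝ 2 μ) : ‖f‖ ^ 2 = ∫ x, f x ^ 2 ∂μ := by
  rw [← real_inner_self_eq_norm_sq, inner_Lp_eq_integral]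
  simp [sq]

/-- The Cauchy–Schwarz inequality for integrals of products. -/
theorem sq_integral_mul_le {α : Type*} {mα : MeasurableSpace α} {μ : Measure α}
    {f g : α → ℝ} (hf : MemLp f 2 μ) (hg : MemLp g 2 μ) :
    (∫ x, f x * g x ∂μ) ^ 2 ≤ (∫ x, f x ^ 2 ∂μ) * ∫ x, g x ^ 2 ∂μ := by
  rw [← inner_toLp_eq_integral hf hg, ← norm_toLp_sq_eq_integral hf, ← norm_toLp_sq_eq_integral hg,
    ← mul_pow]
  exact sq_le_sq' (by linarith [neg_le_of_abs_le (abs_real_inner_le_norm hf.toLp hg.toLp)])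
    (real_inner_le_norm _ _)

/-- A square integrable function on a Euclidean space is bounded in norm by its pairings with
smooth compactly supported functions, which are dense in `L²`. -/
theorem integral_sq_le_of_forall_test {N : ℕ} {u : EuclideanSpace ℝ (Fin N) → ℝ}
    (hu : MemLp u 2 volume) {C : ℝ} (hC : 0 ≤ C)
    (h : ∀ φ : EuclideanSpace ℝ (Fin N) → ℝ, ContDiff ℝ ∞ φ → HasCompactSupport φ →
      (∫ x, u x * φ x) ^ 2 ≤ C * ∫ x, φ x ^ 2) : ∫ x, u x ^ 2 ≤ C := by
  have key : ∀ ψ : Lp ℝ 2 (volume : Measure (EuclideanSpace ℝ (Fin N))),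
      ⟪hu.toLp, ψ⟫_ℝ ^ 2 ≤ C * ‖ψ‖ ^ 2 := by
    intro ψ
    have hd := Lp.dense_hasCompactSupport_contDiff (F := ℝ)
      (μ := (volume : Measure (EuclideanSpace ℝ (Fin N)))) (p := 2) (by norm_num)
    refine hd.induction (P := fun ψ => ⟪hu.toLp, ψ⟫_ℝ ^ 2 ≤ C * ‖ψ‖ ^ 2) ?_ ?_ ψ
    · rintro f ⟨g, hfg, hg, hg'⟩
      have hm : MemLp g 2 volume := hg'.continuous.memLp_of_hasCompactSupport hg
      have : f = hm.toLp := Lp.ext (hfg.trans hm.coeFn_toLp.symm)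
      rw [this, inner_toLp_eq_integral, norm_toLp_sq_eq_integral]
      exact h g hg' hg
    · exact isClosed_le (by fun_prop) (by fun_prop)
  have := key hu.toLp
  rw [real_inner_self_eq_norm_sq, norm_toLp_sq_eq_integral] at this
  by_contra! hlt
  nlinarith

/-! ### Weak gradients on the whole space -/

/-- `G = ∇g` weakly on all of `ℝ^N`, for functions (not classes) `g` and `G` in `L²`. -/
structure HasWeakGradient {N : ℕ} (g : EuclideanSpace ℝ (Fin N) → ℝ)
    (G : EuclideanSpace ℝ (Fin N) → EuclideanSpace ℝ (Fin N)) : Prop where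
  memLp : MemLp g 2 volume
  memLp_grad : MemLp G 2 volume
  integral_eq : ∀ φ : EuclideanSpace ℝ (Fin N) → ℝ, ContDiff ℝ ∞ φ → HasCompactSupport φ →
    ∀ v : EuclideanSpace ℝ (Fin N),
      ∫ x, g x * fderiv ℝ φ x v = - ∫ x, ⟪G x, v⟫_ℝ * φ x

section Translation

variable {N : ℕ} {g : EuclideanSpace ℝ (Fin N) → ℝ}
  {G : EuclideanSpace ℝ (Fin N) → EuclideanSpace ℝ (Fin N)}

/-- Pairings of a locally integrable function with the translates of a smooth function. -/
theorem hasDerivAt_integral_mul_translate (hg : LocallyIntegrable g volume)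
    {φ : EuclideanSpace ℝ (Fin N) → ℝ} (hφ : ContDiff ℝ ∞ φ) (hφc : HasCompactSupport φ)
    (v : EuclideanSpace ℝ (Fin N)) (s : ℝ) :
    HasDerivAt (fun s : ℝ => ∫ x, g x * φ (x - s • v))
      (- ∫ x, g x * fderiv ℝ φ (x - s • v) v) s := by
  set ψ : EuclideanSpace ℝ (Fin N) → ℝ := fun y => φ (-y) with hψ
  have hψ1 : ContDiff ℝ ∞ ψ := hφ.comp contDiff_neg
  have hψc : HasCompactSupport ψ := hφc.comp_homeomorph (Homeomorph.neg _)
  have hd : ∀ y w, fderiv ℝ ψ y w = - fderiv ℝ φ (-y) w := by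
    intro y w
    have h1 : HasFDerivAt φ (fderiv ℝ φ (-y)) (-y) :=
      (hφ.differentiable (by norm_num)).differentiableAt.hasFDerivAt
    have h2 : HasFDerivAt ψ _ y := h1.comp y (hasFDerivAt_id y).neg
    rw [h2.fderiv]; simp
  have h := hψc.hasFDerivAt_convolution_right (ContinuousLinearMap.mul ℝ ℝ) hg
    (hψ1.of_le (by exact_mod_cast le_top)) (s • v)
  have h2 : HasDerivAt (fun s : ℝ => s • v) v s := by
    simpa using (hasDerivAt_id s).smul_const v
  have h3 := h.comp_hasDerivAt s h2
  have e1 : (convolution g ψ (ContinuousLinearMap.mul ℝ ℝ) volume) ∘ (fun s : ℝ => s • v)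
      = fun s : ℝ => ∫ x, g x * φ (x - s • v) := by
    ext t
    simp [convolution, hψ]
  have e2 : (convolution g (fderiv ℝ ψ) ((ContinuousLinearMap.mul ℝ ℝ).precompR
      (EuclideanSpace ℝ (Fin N))) volume) (s • v) v = - ∫ x, g x * fderiv ℝ φ (x - s • v) v := by
    have hi : ConvolutionExistsAt g (fderiv ℝ ψ) (s • v) ((ContinuousLinearMap.mul ℝ ℝ).precompR
      (EuclideanSpace ℝ (Fin N))) volume :=
      (hψc.fderiv ℝ).convolutionExists_right _ hg (hψ1.continuous_fderiv (by norm_num)) _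
    refine (ContinuousLinearMap.integral_apply hi v).trans ?_
    rw [← integral_neg]
    congr 1; ext x
    simp [ContinuousLinearMap.precompR_apply, hd]
  rw [e1, e2] at h3
  exact h3

theorem memLp_translate {F : Type*} [NormedAddCommGroup F] {p : ℝ≥0∞}
    {g : EuclideanSpace ℝ (Fin N) → F} (hg : MemLp g p volume) (w : EuclideanSpace ℝ (Fin N)) :
    MemLp (fun x => g (x + w)) p volume :=
  hg.comp_measurePreserving (measurePreserving_add_right volume w)

theorem contDiff_translate {φ : EuclideanSpace ℝ (Fin N) → ℝ} (hφ : ContDiff ℝ ∞ φ)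
    (w : EuclideanSpace ℝ (Fin N)) : ContDiff ℝ ∞ fun x => φ (x - w) :=
  hφ.comp (contDiff_id.sub contDiff_const)

theorem hasCompactSupport_translate {φ : EuclideanSpace ℝ (Fin N) → ℝ}
    (hφ : HasCompactSupport φ) (w : EuclideanSpace ℝ (Fin N)) :
    HasCompactSupport fun x => φ (x - w) := by
  simpa [sub_eq_add_neg, Function.comp_def] using hφ.comp_homeomorph (Homeomorph.addRight (-w))

theorem HasWeakGradient.hasDerivAt_integral (h : HasWeakGradient g G)
    {φ : EuclideanSpace ℝ (Fin N) → ℝ} (hφ : ContDiff ℝ ∞ φ) (hφc : HasCompactSupport φ)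
    (v : EuclideanSpace ℝ (Fin N)) (s : ℝ) :
    HasDerivAt (fun s : ℝ => ∫ x, g x * φ (x - s • v))
      (∫ x, ⟪G x, v⟫_ℝ * φ (x - s • v)) s := by
  have h1 := hasDerivAt_integral_mul_translate (h.memLp.locallyIntegrable (by norm_num)) hφ hφc v s
  have h2 := h.integral_eq _ (contDiff_translate hφ (s • v))
    (hasCompactSupport_translate hφc (s • v)) v
  have h3 : ∀ x, fderiv ℝ (fun x => φ (x - s • v)) x = fderiv ℝ φ (x - s • v) :=
    fun x => fderiv_comp_sub _
  simp_rw [h3] at h2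
  rw [h2, neg_neg] at h1
  exact h1

theorem integral_translate_mul (g φ : EuclideanSpace ℝ (Fin N) → ℝ)
    (w : EuclideanSpace ℝ (Fin N)) : ∫ x, g (x + w) * φ x = ∫ x, g x * φ (x - w) := by
  simpa using integral_add_right_eq_self (μ := volume) (fun x => g x * φ (x - w)) w

theorem integral_translate (f : EuclideanSpace ℝ (Fin N) → ℝ)
    (w : EuclideanSpace ℝ (Fin N)) : ∫ x, f (x - w) = ∫ x, f x :=
  integral_sub_right_eq_self f w

theorem memLp_test {φ : EuclideanSpace ℝ (Fin N) → ℝ} (hφ : ContDiff ℝ ∞ φ)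
    (hφc : HasCompactSupport φ) : MemLp φ 2 volume :=
  hφ.continuous.memLp_of_hasCompactSupport hφc

theorem sq_integral_inner_mul_le {α E : Type*} {mα : MeasurableSpace α} {μ : Measure α}
    [NormedAddCommGroup E] [InnerProductSpace ℝ E] {G : α → E} {φ : α → ℝ}
    (hG : MemLp G 2 μ) (hφ : MemLp φ 2 μ) (v : E) :
    (∫ x, ⟪G x, v⟫_ℝ * φ x ∂μ) ^ 2 ≤ ‖v‖ ^ 2 * (∫ x, ‖G x‖ ^ 2 ∂μ) * ∫ x, φ x ^ 2 ∂μ := by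
  have hm : MemLp (fun x => ⟪G x, v⟫_ℝ) 2 μ := hG.inner_const v
  refine (sq_integral_mul_le hm hφ).trans ?_
  refine mul_le_mul_of_nonneg_right ?_ (integral_nonneg fun x => sq_nonneg _)
  rw [← integral_const_mul]
  refine integral_mono hm.integrable_sq ((integrable_norm_sq_of_memLp_two hG).const_mul _) ?_
  intro x
  have := abs_real_inner_le_norm (G x) v
  show ⟪G x, v⟫_ℝ ^ 2 ≤ ‖v‖ ^ 2 * ‖G x‖ ^ 2
  rw [← sq_abs, ← mul_pow]
  gcongr
  linarith [mul_comm ‖v‖ ‖G x‖]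

/-- Translation is Lipschitz in `L²` on `W^{1,2}(ℝ^N)`. -/
theorem HasWeakGradient.integral_translate_sub_sq_le (h : HasWeakGradient g G)
    (w : EuclideanSpace ℝ (Fin N)) :
    ∫ x, (g (x + w) - g x) ^ 2 ≤ ‖w‖ ^ 2 * ∫ x, ‖G x‖ ^ 2 := by
  have hG0 : 0 ≤ ∫ x, ‖G x‖ ^ 2 := integral_nonneg fun x => sq_nonneg _
  have hgw := memLp_translate h.memLp w
  refine integral_sq_le_of_forall_test (hgw.sub h.memLp) (by positivity) fun φ hφ hφc => ?_
  have hφm := memLp_test hφ hφc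
  have hφ0 : 0 ≤ ∫ x, φ x ^ 2 := integral_nonneg fun x => sq_nonneg _
  set C := √(‖w‖ ^ 2 * (∫ x, ‖G x‖ ^ 2) * ∫ x, φ x ^ 2)
  have e : ∫ x, (g (x + w) - g x) * φ x
      = (∫ x, g x * φ (x - (1 : ℝ) • w)) - ∫ x, g x * φ (x - (0 : ℝ) • w) := by
    simp only [sub_mul, one_smul, zero_smul, sub_zero]
    rw [integral_sub (integrable_mul_of_memLp_two hgw hφm)
      (integrable_mul_of_memLp_two h.memLp hφm), integral_translate_mul]
  have hb : ∀ s : ℝ, ‖∫ x, ⟪G x, w⟫_ℝ * φ (x - s • w)‖ ≤ C := by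
    intro s
    refine Real.le_sqrt_of_sq_le ?_
    rw [Real.norm_eq_abs, sq_abs]
    refine (sq_integral_inner_mul_le h.memLp_grad (memLp_test (contDiff_translate hφ (s • w))
      (hasCompactSupport_translate hφc (s • w))) w).trans_eq ?_
    rw [integral_translate (fun x => φ x ^ 2)]
  have := Convex.norm_image_sub_le_of_norm_hasDerivWithin_le (s := univ) (x := (0 : ℝ)) (y := 1)
    (fun s _ => (h.hasDerivAt_integral hφ hφc w s).hasDerivWithinAt) (fun s _ => hb s)
    convex_univ (mem_univ _) (mem_univ _)
  rw [← e, Real.norm_eq_abs] at this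
  simp only [sub_zero, norm_one, mul_one] at this
  rw [← sq_abs]
  calc _ ≤ C ^ 2 := pow_le_pow_left₀ (abs_nonneg _) this 2
    _ = _ := Real.sq_sqrt (by positivity)

/-- Difference quotients converge weakly in `L²` to the directional weak derivative. -/
theorem HasWeakGradient.tendsto_integral_slope (h : HasWeakGradient g G)
    (v : EuclideanSpace ℝ (Fin N)) {ψ : EuclideanSpace ℝ (Fin N) → ℝ} (hψ : MemLp ψ 2 volume) :
    Tendsto (fun t : ℝ => t⁻¹ * ∫ x, (g (x + t • v) - g x) * ψ x) (𝓝[≠] 0)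
      (𝓝 (∫ x, ⟪G x, v⟫_ℝ * ψ x)) := by
  -- Both sides are bounded functionals of `ψ`, uniformly in `t`; on test functions this is
  -- the derivative computed above.
  set M := √(‖v‖ ^ 2 * ∫ x, ‖G x‖ ^ 2)
  have hG0 : 0 ≤ ∫ x, ‖G x‖ ^ 2 := integral_nonneg fun x => sq_nonneg _
  have hM2 : M ^ 2 = ‖v‖ ^ 2 * ∫ x, ‖G x‖ ^ 2 := Real.sq_sqrt (by positivity)
  have hM0 : 0 ≤ M := Real.sqrt_nonneg _
  have hdiff : ∀ t : ℝ, MemLp (fun x => g (x + t • v) - g x) 2 volume :=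
    fun t => (memLp_translate h.memLp _).sub h.memLp
  have hv : MemLp (fun x => ⟪G x, v⟫_ℝ) 2 volume := h.memLp_grad.inner_const v
  have b1 : ∀ (t : ℝ) (η : EuclideanSpace ℝ (Fin N) → ℝ) (_ : MemLp η 2 volume),
      t ≠ 0 → |t⁻¹ * ∫ x, (g (x + t • v) - g x) * η x| ≤ M * √(∫ x, η x ^ 2) := by
    intro t η hη ht
    have hη0 : 0 ≤ ∫ x, η x ^ 2 := integral_nonneg fun x => sq_nonneg _
    refine abs_le_of_sq_le_sq ?_ (by positivity)
    rw [mul_pow, mul_pow, Real.sq_sqrt hη0, hM2]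
    have h1 := sq_integral_mul_le (hdiff t) hη
    have h2 := h.integral_translate_sub_sq_le (t • v)
    calc _ ≤ t⁻¹ ^ 2 * ((‖t • v‖ ^ 2 * ∫ x, ‖G x‖ ^ 2) * ∫ x, η x ^ 2) := by
          gcongr; exact h1.trans (by gcongr)
      _ = _ := by
          rw [norm_smul, mul_pow, Real.norm_eq_abs, sq_abs]; field_simp
  have b2 : ∀ (η : EuclideanSpace ℝ (Fin N) → ℝ) (_ : MemLp η 2 volume),
      |∫ x, ⟪G x, v⟫_ℝ * η x| ≤ M * √(∫ x, η x ^ 2) := by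
    intro η hη
    have hη0 : 0 ≤ ∫ x, η x ^ 2 := integral_nonneg fun x => sq_nonneg _
    refine abs_le_of_sq_le_sq ?_ (by positivity)
    rw [mul_pow, Real.sq_sqrt hη0, hM2]
    exact sq_integral_inner_mul_le h.memLp_grad hη v
  rw [Metric.tendsto_nhds]
  intro ε hε
  obtain ⟨φ, hφc, hφ, hφd⟩ := hψ.exist_eLpNorm_sub_le (by norm_num) (by norm_num)
    (show (0 : ℝ) < ε / (3 * (M + 1)) by positivity)
  have hφm := memLp_test hφ hφc
  have hη : MemLp (fun x => ψ x - φ x) 2 volume := hψ.sub hφm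
  have hηb : M * √(∫ x, (ψ x - φ x) ^ 2) ≤ ε / 3 := by
    have e1 : √(∫ x, (ψ x - φ x) ^ 2) = ‖hη.toLp‖ := by
      rw [← norm_toLp_sq_eq_integral hη, Real.sqrt_sq (norm_nonneg _)]
    rw [e1, Lp.norm_toLp]
    have := ENNReal.toReal_le_of_le_ofReal (by positivity) hφd
    calc M * _ ≤ (M + 1) * (ε / (3 * (M + 1))) := by
          refine mul_le_mul (by linarith) this ENNReal.toReal_nonneg (by positivity)
      _ = ε / 3 := by field_simp
  have hlim : Tendsto (fun t : ℝ => t⁻¹ * ∫ x, (g (x + t • v) - g x) * φ x) (𝓝[≠] 0)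
      (𝓝 (∫ x, ⟪G x, v⟫_ℝ * φ x)) := by
    have := (h.hasDerivAt_integral hφ hφc v 0).tendsto_slope
    simp only [zero_smul, sub_zero] at this
    refine this.congr fun t => ?_
    simp only [slope, vsub_eq_sub, sub_zero, smul_eq_mul, zero_smul]
    congr 1
    simp only [sub_mul]
    rw [integral_sub (integrable_mul_of_memLp_two (memLp_translate h.memLp _) hφm)
      (integrable_mul_of_memLp_two h.memLp hφm), integral_translate_mul]
  filter_upwards [(Metric.tendsto_nhds.1 hlim) (ε / 3) (by positivity), self_mem_nhdsWithin]
    with t ht ht0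
  rw [Real.dist_eq] at ht ⊢
  have s1 : t⁻¹ * ∫ x, (g (x + t • v) - g x) * ψ x =
      t⁻¹ * (∫ x, (g (x + t • v) - g x) * φ x)
        + t⁻¹ * ∫ x, (g (x + t • v) - g x) * (ψ x - φ x) := by
    rw [← mul_add, ← integral_add (integrable_mul_of_memLp_two (hdiff t) hφm)
      (integrable_mul_of_memLp_two (hdiff t) hη)]
    congr 2; ext x; ring
  have s2 : ∫ x, ⟪G x, v⟫_ℝ * ψ x =
      (∫ x, ⟪G x, v⟫_ℝ * φ x) + ∫ x, ⟪G x, v⟫_ℝ * (ψ x - φ x) := by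
    rw [← integral_add (integrable_mul_of_memLp_two hv hφm) (integrable_mul_of_memLp_two hv hη)]
    congr 1; ext x; ring
  rw [s1, s2]
  have c1 := b1 t _ hη ht0
  have c2 := b2 _ hη
  rw [abs_le] at c1 c2
  rw [abs_lt] at ht ⊢
  constructor <;> linarith [c1.1, c1.2, c2.1, c2.2, ht.1, ht.2]

end Translation

/-! ### The chain rule -/

/-- `ψ : ℝ → ℝ` fixes `0` and is approximated to second order, uniformly, by its derivative `ψ'`,
which is bounded by `1`; in particular `ψ` is a contraction. -/
structure IsC11Contraction (ψ ψ' : ℝ → ℝ) (C : ℝ) : Prop where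
  map_zero : ψ 0 = 0
  abs_deriv_le : ∀ a, |ψ' a| ≤ 1
  continuous_deriv : Continuous ψ'
  taylor : ∀ a b, |ψ b - ψ a - ψ' a * (b - a)| ≤ C * (b - a) ^ 2

namespace IsC11Contraction

variable {ψ ψ' : ℝ → ℝ} {C : ℝ}

theorem hasDerivAt (h : IsC11Contraction ψ ψ' C) (a : ℝ) : HasDerivAt ψ (ψ' a) a := by
  rw [hasDerivAt_iff_isLittleO]
  have h1 : (fun b => ψ b - ψ a - (b - a) • ψ' a) =O[𝓝 a] fun b => (b - a) ^ 2 := by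
    refine Asymptotics.IsBigO.of_bound C (Eventually.of_forall fun b => ?_)
    rw [Real.norm_eq_abs, Real.norm_eq_abs, abs_of_nonneg (sq_nonneg (b - a)), smul_eq_mul,
      mul_comm (b - a)]
    exact h.taylor a b
  refine h1.trans_isLittleO ?_
  have h2 : (fun b => b - a) =o[𝓝 a] fun _ => (1 : ℝ) := by
    rw [Asymptotics.isLittleO_one_iff]
    have hc : Continuous fun b : ℝ => b - a := by fun_prop
    simpa using hc.tendsto a
  simpa [sq] using h2.mul_isBigO (Asymptotics.isBigO_refl (fun b => b - a) (𝓝 a))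

theorem abs_sub_le (h : IsC11Contraction ψ ψ' C) (a b : ℝ) : |ψ b - ψ a| ≤ |b - a| := by
  simpa using Convex.norm_image_sub_le_of_norm_hasDerivWithin_le (C := 1) (s := univ) (x := a)
    (y := b) (fun x _ => (h.hasDerivAt x).hasDerivWithinAt) (fun x _ => h.abs_deriv_le x)
    convex_univ (mem_univ _) (mem_univ _)

theorem continuous (h : IsC11Contraction ψ ψ' C) : Continuous ψ := by
  have : LipschitzWith 1 ψ := LipschitzWith.of_dist_le_mul fun x y => by
    simpa [Real.dist_eq] using h.abs_sub_le y x
  exact this.continuous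

theorem abs_le (h : IsC11Contraction ψ ψ' C) (a : ℝ) : |ψ a| ≤ |a| := by
  simpa [h.map_zero] using h.abs_sub_le 0 a

theorem memLp_comp (h : IsC11Contraction ψ ψ' C) {α : Type*} {mα : MeasurableSpace α}
    {μ : Measure α} {g : α → ℝ} (hg : MemLp g 2 μ) : MemLp (fun x => ψ (g x)) 2 μ :=
  hg.mono (h.continuous.comp_aestronglyMeasurable hg.1) (Eventually.of_forall fun x => by
    simpa using h.abs_le (g x))

theorem memLp_smul (h : IsC11Contraction ψ ψ' C) {α F : Type*} {mα : MeasurableSpace α}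
    {μ : Measure α} [NormedAddCommGroup F] [NormedSpace ℝ F] {g : α → ℝ} {G : α → F}
    (hg : AEStronglyMeasurable g μ) (hG : MemLp G 2 μ) :
    MemLp (fun x => ψ' (g x) • G x) 2 μ :=
  hG.mono ((h.continuous_deriv.comp_aestronglyMeasurable hg).smul hG.1)
    (Eventually.of_forall fun x => by
      rw [norm_smul, Real.norm_eq_abs]
      exact mul_le_of_le_one_left (norm_nonneg _) (h.abs_deriv_le _))

end IsC11Contraction

section

variable {N : ℕ}

theorem abs_integral_le_integral_of_abs_le {α : Type*} {mα : MeasurableSpace α} {μ : Measure α}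
    {f g : α → ℝ} (hg : Integrable g μ) (h : ∀ x, |f x| ≤ g x) : |∫ x, f x ∂μ| ≤ ∫ x, g x ∂μ :=
  norm_integral_le_of_norm_le (f := f) hg (Eventually.of_forall h)

/-- The chain rule on the whole space. The second-order Taylor estimate is matched by the
quadratic bound on translates, so that difference quotients suffice and no smoothing of `g`
is needed. -/
theorem HasWeakGradient.integral_comp {g : EuclideanSpace ℝ (Fin N) → ℝ}
    {G : EuclideanSpace ℝ (Fin N) → EuclideanSpace ℝ (Fin N)} (h : HasWeakGradient g G)
    {ψ ψ' : ℝ → ℝ} {C : ℝ} (hψ : IsC11Contraction ψ ψ' C)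
    {φ : EuclideanSpace ℝ (Fin N) → ℝ} (hφ : ContDiff ℝ ∞ φ) (hφc : HasCompactSupport φ)
    (v : EuclideanSpace ℝ (Fin N)) :
    ∫ x, ψ (g x) * fderiv ℝ φ x v = - ∫ x, ⟪ψ' (g x) • G x, v⟫_ℝ * φ x := by
  have hC : 0 ≤ C := by
    have := (abs_nonneg _).trans (hψ.taylor 0 1); simpa using this
  have hφm := memLp_test hφ hφc
  have hψg := hψ.memLp_comp h.memLp
  have hψφ : MemLp (fun x => ψ' (g x) * φ x) 2 volume := hψ.memLp_smul h.memLp.1 hφm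
  obtain ⟨B, hB⟩ := hφc.exists_bound_of_continuous hφ.continuous
  have hB0 : 0 ≤ B := (norm_nonneg _).trans (hB 0)
  set I := ∫ x, ‖G x‖ ^ 2
  -- the derivative at `0` of `t ↦ ∫ ψ(g(x)) φ(x - t v) dx`, computed in two ways
  have d1 := (hasDerivAt_integral_mul_translate (hψg.locallyIntegrable (by norm_num))
    hφ hφc v 0).tendsto_slope
  simp only [zero_smul, sub_zero] at d1
  have d2 := h.tendsto_integral_slope v hψφ
  set R : ℝ → ℝ := fun t =>
    ∫ x, (ψ (g (x + t • v)) - ψ (g x) - ψ' (g x) * (g (x + t • v) - g x)) * φ x with hR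
  have hgt : ∀ t : ℝ, MemLp (fun x => g (x + t • v) - g x) 2 volume := fun t =>
    (memLp_translate h.memLp (t • v)).sub h.memLp
  have hRb : ∀ t : ℝ, |R t| ≤ C * B * (t ^ 2 * (‖v‖ ^ 2 * I)) := by
    intro t
    refine (abs_integral_le_integral_of_abs_le ((hgt t).integrable_sq.const_mul (C * B))
      fun x => ?_).trans ?_
    · rw [abs_mul]
      calc _ ≤ (C * (g (x + t • v) - g x) ^ 2) * B :=
            mul_le_mul (hψ.taylor _ _) (hB x) (abs_nonneg _) (by positivity)
        _ = _ := by ring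
    · rw [integral_const_mul]
      refine mul_le_mul_of_nonneg_left ((h.integral_translate_sub_sq_le (t • v)).trans_eq ?_)
        (by positivity)
      rw [norm_smul, mul_pow, Real.norm_eq_abs, sq_abs]; ring
  have hR0 : Tendsto (fun t => t⁻¹ * R t) (𝓝[≠] 0) (𝓝 0) := by
    refine squeeze_zero_norm' (a := fun t => |t| * (C * B * (‖v‖ ^ 2 * I))) ?_ ?_
    · filter_upwards [self_mem_nhdsWithin] with t ht
      have ht' : 0 < |t| := abs_pos.2 ht
      rw [Real.norm_eq_abs, abs_mul, abs_inv, inv_mul_le_iff₀ ht']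
      refine (hRb t).trans_eq ?_
      rw [← sq_abs t]; ring
    · have : Tendsto (fun t : ℝ => |t| * (C * B * (‖v‖ ^ 2 * I))) (𝓝 0) (𝓝 0) := by
        have hc : Continuous fun t : ℝ => |t| * (C * B * (‖v‖ ^ 2 * I)) := by fun_prop
        simpa using hc.tendsto 0
      exact this.mono_left nhdsWithin_le_nhds
  have d3 := d2.add hR0
  have heq : (fun t : ℝ => t⁻¹ * ∫ x, (g (x + t • v) - g x) * (ψ' (g x) * φ x)) +
      (fun t => t⁻¹ * R t)
      = slope (fun s : ℝ => ∫ x, ψ (g x) * φ (x - s • v)) 0 := by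
    ext t
    have hψt : MemLp (fun x => ψ (g (x + t • v))) 2 volume :=
      hψ.memLp_comp (memLp_translate h.memLp _)
    simp only [Pi.add_apply, slope, vsub_eq_sub, sub_zero, smul_eq_mul, zero_smul, hR]
    rw [← mul_add, ← integral_translate_mul (fun x => ψ (g x)),
      ← integral_sub (integrable_mul_of_memLp_two hψt hφm) (integrable_mul_of_memLp_two hψg hφm),
      ← integral_add (integrable_mul_of_memLp_two (hgt t) hψφ)]
    · congr 2; ext x; ring
    · have i1 := integrable_mul_of_memLp_two (hψt.sub hψg) hφm
      have i2 := integrable_mul_of_memLp_two (hgt t) hψφ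
      refine (i1.sub i2).congr (Eventually.of_forall fun x => ?_)
      simp only [Pi.sub_apply]; ring
  have d3' := d3.congr fun t => congrFun heq t
  have := tendsto_nhds_unique d1 d3'
  rw [add_zero, neg_eq_iff_eq_neg] at this
  rw [this]
  congr 2; ext x
  rw [real_inner_smul_left]; ring

/-! ### Cutoffs and localization -/

/-- A smooth cutoff between a compact set and an open neighbourhood of it. -/
theorem exists_isTestFunction_eq_one {Ω K : Set (EuclideanSpace ℝ (Fin N))} (hΩ : IsOpen Ω)
    (hK : IsCompact K) (hKΩ : K ⊆ Ω) :
    ∃ χ : EuclideanSpace ℝ (Fin N) → ℝ, IsTestFunction Ω χ ∧ (∀ᶠ x in 𝓝ˢ K, χ x = 1) ∧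
      ∀ x, χ x ∈ Icc (0 : ℝ) 1 := by
  obtain ⟨K', hK', h1, h2⟩ := exists_compact_between hK hΩ hKΩ
  obtain ⟨χ, a, b, c⟩ := exists_contMDiffMap_one_nhds_of_subset_interior (n := ⊤)
    (modelWithCornersSelf ℝ (EuclideanSpace ℝ (Fin N))) hK.isClosed h1
  have hs : tsupport χ ⊆ K' := by
    refine closure_minimal (fun x hx => ?_) hK'.isClosed
    by_contra hxK
    exact hx (b x hxK)
  exact ⟨χ, ⟨χ.contMDiff.contDiff, hK'.of_isClosed_subset (isClosed_tsupport _) hs, hs.trans h2⟩,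
    a, c⟩

theorem fderiv_eq_zero_of_notMem_tsupport {φ : EuclideanSpace ℝ (Fin N) → ℝ}
    {x : EuclideanSpace ℝ (Fin N)} (hx : x ∉ tsupport φ) : fderiv ℝ φ x = 0 := by
  by_contra h
  exact hx (support_fderiv_subset ℝ h)

/-- The extension by zero of `χ f` belongs to `W^{1,2}(ℝ^N)` for a cutoff `χ` and
`f ∈ W^{1,2}(Ω)`. -/
theorem IsWeakGradient.hasWeakGradient_cutoff {Ω : Set (EuclideanSpace ℝ (Fin N))}
    (hΩ : IsOpen Ω) {f : L2 Ω} {F : L2Field Ω} (h : IsWeakGradient f F)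
    {χ : EuclideanSpace ℝ (Fin N) → ℝ} (hχ : IsTestFunction Ω χ) :
    HasWeakGradient (Ω.indicator fun x => χ x * f x)
      (Ω.indicator fun x => χ x • F x + f x • gradient χ x) := by
  obtain ⟨hχ1, hχ2, hχ3⟩ := hχ
  obtain ⟨B, hB⟩ := hχ2.exists_bound_of_continuous hχ1.continuous
  have hχc : Continuous (fderiv ℝ χ) := hχ1.continuous_fderiv (by norm_num)
  have hgc : Continuous (gradient χ) := (InnerProductSpace.toDual ℝ _).symm.continuous.comp hχc
  obtain ⟨B', hB'⟩ := (hχ2.fderiv ℝ).exists_bound_of_continuous hχc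
  have hgn : ∀ x, ‖gradient χ x‖ ≤ B' := fun x => by
    rw [gradient, LinearIsometryEquiv.norm_map]; exact hB' x
  have m1 : MemLp (fun x => χ x * f x) 2 (volume.restrict Ω) :=
    (Lp.memLp f).of_le_mul (c := B) (hχ1.continuous.aestronglyMeasurable.mul (Lp.memLp f).1)
      (Eventually.of_forall fun x => by
        rw [norm_mul]; exact mul_le_mul_of_nonneg_right (hB x) (norm_nonneg _))
  have m2 : MemLp (fun x => χ x • F x) 2 (volume.restrict Ω) :=
    (Lp.memLp F).of_le_mul (c := B) (hχ1.continuous.aestronglyMeasurable.smul (Lp.memLp F).1)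
      (Eventually.of_forall fun x => by
        rw [norm_smul]; exact mul_le_mul_of_nonneg_right (hB x) (norm_nonneg _))
  have m3 : MemLp (fun x => f x • gradient χ x) 2 (volume.restrict Ω) :=
    (Lp.memLp f).of_le_mul (c := B') ((Lp.memLp f).1.smul hgc.aestronglyMeasurable)
      (Eventually.of_forall fun x => by
        rw [norm_smul, mul_comm]
        exact mul_le_mul_of_nonneg_right (hgn x) (norm_nonneg _))
  refine ⟨(memLp_indicator_iff_restrict hΩ.measurableSet).2 m1,
    (memLp_indicator_iff_restrict hΩ.measurableSet).2 (m2.add m3), fun φ hφ hφc v => ?_⟩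
  have hT : IsTestFunction Ω (fun x => χ x * φ x) :=
    ⟨hχ1.mul hφ, hφc.mul_left, (tsupport_mul_subset_left).trans hχ3⟩
  have e := h _ hT v
  have hφm := (memLp_test hφ hφc).restrict Ω
  have hφd : MemLp (fun x => fderiv ℝ φ x v) 2 (volume.restrict Ω) := by
    have hc : Continuous fun x => fderiv ℝ φ x v :=
      (hφ.continuous_fderiv (by norm_num)).clm_apply continuous_const
    exact (hc.memLp_of_hasCompactSupport (hφc.fderiv_apply ℝ v))
  have fd : ∀ x, fderiv ℝ (fun x => χ x * φ x) x v
      = χ x * fderiv ℝ φ x v + φ x * ⟪gradient χ x, v⟫_ℝ := by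
    intro x
    have h1 := (hχ1.differentiable (by norm_num)).differentiableAt (x := x)
    have h2 := (hφ.differentiable (by norm_num)).differentiableAt (x := x)
    rw [fderiv_fun_mul h1 h2, inner_gradient_left]
    simp
  have l : ∫ x, Ω.indicator (fun x => χ x * f x) x * fderiv ℝ φ x v
      = ∫ x in Ω, χ x * f x * fderiv ℝ φ x v := by
    rw [← integral_indicator hΩ.measurableSet]
    congr 1; ext x
    by_cases hx : x ∈ Ω <;> simp [hx]
  have r : ∫ x, ⟪Ω.indicator (fun x => χ x • F x + f x • gradient χ x) x, v⟫_ℝ * φ x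
      = ∫ x in Ω, ⟪χ x • F x + f x • gradient χ x, v⟫_ℝ * φ x := by
    rw [← integral_indicator hΩ.measurableSet]
    congr 1; ext x
    by_cases hx : x ∈ Ω <;> simp [hx]
  rw [l, r]
  have i1 := integrable_mul_of_memLp_two m1 hφd
  have i2 := integrable_mul_of_memLp_two (m2.inner_const v) hφm
  have i3 := integrable_mul_of_memLp_two (m3.inner_const v) hφm
  have e1 : ∫ x in Ω, f x * fderiv ℝ (fun x => χ x * φ x) x v
      = (∫ x in Ω, χ x * f x * fderiv ℝ φ x v) + ∫ x in Ω, ⟪f x • gradient χ x, v⟫_ℝ * φ x := by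
    rw [← integral_add i1 i3]
    congr 1; ext x
    rw [fd, real_inner_smul_left]; ring
  have e2 : ∫ x in Ω, ⟪F x, v⟫_ℝ * (χ x * φ x) = ∫ x in Ω, ⟪χ x • F x, v⟫_ℝ * φ x := by
    congr 1; ext x
    rw [real_inner_smul_left]; ring
  have e3 : ∫ x in Ω, ⟪χ x • F x + f x • gradient χ x, v⟫_ℝ * φ x
      = (∫ x in Ω, ⟪χ x • F x, v⟫_ℝ * φ x) + ∫ x in Ω, ⟪f x • gradient χ x, v⟫_ℝ * φ x := by
    rw [← integral_add i2 i3]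
    congr 1; ext x
    rw [inner_add_left]; ring
  rw [e1, e2] at e
  rw [e3]
  linarith

/-- The chain rule in `W^{1,2}(Ω)`. -/
theorem IsWeakGradient.exists_comp {Ω : Set (EuclideanSpace ℝ (Fin N))}
    (hΩ : IsOpen Ω) {f : L2 Ω} {F : L2Field Ω} (h : IsWeakGradient f F)
    {ψ ψ' : ℝ → ℝ} {C : ℝ} (hψ : IsC11Contraction ψ ψ' C) :
    ∃ (u : L2 Ω) (U : L2Field Ω), IsWeakGradient u U ∧
      (u =ᵐ[volume.restrict Ω] fun x => ψ (f x)) ∧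
      (U =ᵐ[volume.restrict Ω] fun x => ψ' (f x) • F x) := by
  have m1 := hψ.memLp_comp (Lp.memLp f)
  have m2 := hψ.memLp_smul (Lp.memLp f).1 (Lp.memLp F)
  refine ⟨m1.toLp, m2.toLp, fun φ hφ v => ?_, m1.coeFn_toLp, m2.coeFn_toLp⟩
  obtain ⟨χ, hχ, hχ1, -⟩ := exists_isTestFunction_eq_one hΩ hφ.2.1 hφ.2.2
  have hw := (h.hasWeakGradient_cutoff hΩ hχ).integral_comp hψ hφ.1 hφ.2.1 v
  have hone : ∀ x ∈ tsupport φ, χ x = 1 := fun x hx => hχ1.self_of_nhdsSet x hx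
  have hgrad : ∀ x ∈ tsupport φ, gradient χ x = 0 := by
    intro x hx
    have : χ =ᶠ[𝓝 x] fun _ => 1 := hχ1.filter_mono (nhds_le_nhdsSet hx)
    rw [gradient, this.fderiv_eq]; simp
  have e1 : ∫ x in Ω, (m1.toLp : L2 Ω) x * fderiv ℝ φ x v = ∫ x in Ω, ψ (f x) * fderiv ℝ φ x v := by
    refine integral_congr_ae ?_
    filter_upwards [m1.coeFn_toLp] with x hx
    rw [hx]
  have e2 : ∫ x in Ω, ⟪(m2.toLp : L2Field Ω) x, v⟫_ℝ * φ x
      = ∫ x in Ω, ⟪ψ' (f x) • F x, v⟫_ℝ * φ x := by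
    refine integral_congr_ae ?_
    filter_upwards [m2.coeFn_toLp] with x hx
    rw [hx]
  rw [e1, e2]
  have z1 : ∀ x ∉ tsupport φ, φ x = 0 := fun x hx => image_eq_zero_of_notMem_tsupport hx
  have z2 : ∀ x ∉ tsupport φ, fderiv ℝ φ x v = 0 := fun x hx => by
    rw [fderiv_eq_zero_of_notMem_tsupport hx]; rfl
  rw [setIntegral_eq_integral_of_forall_compl_eq_zero fun x hx => by
      rw [z2 x (fun h => hx (hφ.2.2 h)), mul_zero],
    setIntegral_eq_integral_of_forall_compl_eq_zero fun x hx => by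
      rw [z1 x (fun h => hx (hφ.2.2 h)), mul_zero]]
  convert hw using 3 with x
  · by_cases hx : x ∈ tsupport φ
    · rw [indicator_of_mem (hφ.2.2 hx), hone x hx, one_mul]
    · rw [z2 x hx, mul_zero, mul_zero]
  · ext x
    by_cases hx : x ∈ tsupport φ
    · rw [indicator_of_mem (hφ.2.2 hx), indicator_of_mem (hφ.2.2 hx), hone x hx, hgrad x hx,
        one_mul, one_smul, smul_zero, add_zero]
    · rw [z1 x hx, mul_zero, mul_zero]

end

/-! ### The Sobolev inequality on small sets -/

section

variable {N : ℕ} {Ω : Set (EuclideanSpace ℝ (Fin N))}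

theorem IsWeakGradient.Qform_eq (hΩ : IsOpen Ω) {f : L2 Ω} {F : L2Field Ω}
    (h : IsWeakGradient f F) : Qform f = ∫⁻ x in Ω, ‖F x‖ₑ ^ 2 := by
  refine le_antisymm (iInf₂_le F h) (le_iInf₂ fun G hG => ?_)
  rw [h.unique hΩ hG]

theorem lintegral_enorm_sq_eq {α E : Type*} {mα : MeasurableSpace α} {μ : Measure α}
    [NormedAddCommGroup E] {F : α → E} (hF : MemLp F 2 μ) :
    ∫⁻ x, ‖F x‖ₑ ^ 2 ∂μ = ENNReal.ofReal (∫ x, ‖F x‖ ^ 2 ∂μ) := by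
  rw [ofReal_integral_eq_lintegral_ofReal (integrable_norm_sq_of_memLp_two hF)
    (Eventually.of_forall fun x => sq_nonneg _)]
  congr 1; ext x
  rw [ENNReal.ofReal_pow (norm_nonneg _), ofReal_norm]

theorem eLpNorm_two_toReal_sq {α : Type*} {mα : MeasurableSpace α} {μ : Measure α}
    {f : α → ℝ} (hf : MemLp f 2 μ) : (eLpNorm f 2 μ).toReal ^ 2 = ∫ x, f x ^ 2 ∂μ := by
  rw [← norm_toLp_sq_eq_integral hf, Lp.norm_toLp]

theorem enorm_sq_Lp_eq (f : L2 Ω) : ‖f‖ₑ ^ 2 = ENNReal.ofReal (∫ x in Ω, f x ^ 2) := by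
  rw [← norm_Lp_sq_eq_integral, ENNReal.ofReal_pow (norm_nonneg _), ofReal_norm]

theorem IsWeakGradient.normW12_eq (hΩ : IsOpen Ω) {f : L2 Ω} {F : L2Field Ω}
    (h : IsWeakGradient f F) :
    normW12 f = ENNReal.ofReal ((∫ x in Ω, f x ^ 2) + ∫ x in Ω, ‖F x‖ ^ 2) ^ (1 / 2 : ℝ) := by
  rw [normW12, h.Qform_eq hΩ, enorm_sq_Lp_eq, lintegral_enorm_sq_eq (Lp.memLp F),
    ENNReal.ofReal_add (integral_nonneg fun x => sq_nonneg _)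
      (integral_nonneg fun x => sq_nonneg _)]

/-- The `L²` mass on a set `A ⊆ Ω` of a function in `W^{1,2}(Ω)` is at most `C |A|^θ` times the
square of its `W^{1,2}(Ω)` norm. -/
def HasSmallSetBound (Ω : Set (EuclideanSpace ℝ (Fin N))) (C θ : ℝ) : Prop :=
  ∀ (u : L2 Ω) (U : L2Field Ω), IsWeakGradient u U → ∀ A ⊆ Ω, MeasurableSet A →
    ∫ x in A, u x ^ 2 ≤
      C * volume.real A ^ θ * ((∫ x in Ω, u x ^ 2) + ∫ x in Ω, ‖U x‖ ^ 2)

/-- By Hölder's inequality, a Sobolev inequality with an exponent `q > 2` makes the `L²` mass of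
a function in `W^{1,2}(Ω)` on a set `A` small with `|A|`. This is the only form in which the
Sobolev inequality is used below. -/
theorem SobolevInequality.exists_setIntegral_sq_le (hΩ : IsOpen Ω) (hfin : volume Ω < ⊤)
    {q : ℝ≥0∞} {c : ℝ} (hq : 2 < q) (hc : 0 < c) (h : SobolevInequality Ω q c) :
    ∃ C θ : ℝ, 0 < C ∧ 0 < θ ∧ HasSmallSetBound Ω C θ := by
  -- for `q = ∞` the junk value `(∞).toReal⁻¹ = 0` is the right exponent
  set t : ℝ := 1 / (2 : ℝ≥0∞).toReal - 1 / q.toReal with ht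
  have ht0 : 0 < t := by
    rcases eq_or_ne q ⊤ with rfl | hq'
    · simp [ht]
    · have : 2 < q.toReal := by
        have := (ENNReal.toReal_lt_toReal (by norm_num) hq').2 hq
        simpa using this
      have h2 : 1 / q.toReal < 1 / 2 := one_div_lt_one_div_of_lt (by norm_num) this
      simp only [ht, ENNReal.toReal_ofNat]; linarith
  refine ⟨c ^ 2, t * 2, by positivity, by positivity, fun u U hu A hA hAm => ?_⟩
  have hAfin : volume A ≠ ⊤ := ((measure_mono hA).trans_lt hfin).ne
  set E := (∫ x in Ω, u x ^ 2) + ∫ x in Ω, ‖U x‖ ^ 2 with hE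
  have hE0 : 0 ≤ E :=
    add_nonneg (integral_nonneg fun x => sq_nonneg _) (integral_nonneg fun x => sq_nonneg _)
  have hμ : volume.restrict A ≤ volume.restrict Ω := Measure.restrict_mono_set _ hA
  have huA : MemLp u 2 (volume.restrict A) := (Lp.memLp u).mono_measure hμ
  have h1 : eLpNorm u 2 (volume.restrict A)
      ≤ ENNReal.ofReal c * ENNReal.ofReal E ^ (1 / 2 : ℝ) * volume A ^ t := by
    have := eLpNorm_le_eLpNorm_mul_rpow_measure_univ hq.le huA.1
    rw [Measure.restrict_apply_univ] at this
    refine this.trans ?_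
    refine mul_le_mul_left ?_ _
    refine (eLpNorm_mono_measure u hμ).trans ?_
    rw [hE, ← hu.normW12_eq hΩ]
    exact h u ⟨U, hu⟩
  have h2 := ENNReal.toReal_mono (by
    refine ENNReal.mul_ne_top (ENNReal.mul_ne_top ENNReal.ofReal_ne_top ?_) ?_
    · exact ENNReal.rpow_ne_top_of_nonneg (by norm_num) ENNReal.ofReal_ne_top
    · exact ENNReal.rpow_ne_top_of_nonneg ht0.le hAfin) h1
  rw [ENNReal.toReal_mul, ENNReal.toReal_mul, ← ENNReal.toReal_rpow, ← ENNReal.toReal_rpow,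
    ENNReal.toReal_ofReal hc.le, ENNReal.toReal_ofReal hE0] at h2
  rw [← eLpNorm_two_toReal_sq huA]
  refine (pow_le_pow_left₀ ENNReal.toReal_nonneg h2 2).trans_eq ?_
  rw [mul_pow, mul_pow, ← Real.sqrt_eq_rpow, Real.sq_sqrt hE0,
    Real.rpow_mul measureReal_nonneg, Real.rpow_two, Measure.real]
  ring

end

/-! ### A Poincaré inequality for functions with zero mean on small cubes -/

section

variable {N : ℕ}

/-- The index of the half-open cube of side `δ` of the grid `δ ℤ^N` which contains `x`. -/
noncomputable def cellIndex (δ : ℝ) (x : EuclideanSpace ℝ (Fin N)) : Fin N → ℤ :=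
  fun i => ⌊x i / δ⌋

theorem measurable_cellIndex (δ : ℝ) : Measurable (cellIndex (N := N) δ) := by
  refine measurable_pi_lambda _ fun i => Int.measurable_floor.comp ?_
  have : Continuous fun x : EuclideanSpace ℝ (Fin N) => x i / δ := by fun_prop
  exact this.measurable

theorem norm_sub_le_of_cellIndex_eq {δ : ℝ} (hδ : 0 < δ) {x y : EuclideanSpace ℝ (Fin N)}
    (h : cellIndex δ x = cellIndex δ y) : ‖y - x‖ ≤ √N * δ := by
  rw [EuclideanSpace.norm_eq]
  refine Real.sqrt_le_left (by positivity) |>.2 ?_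
  rw [mul_pow, Real.sq_sqrt (by positivity)]
  calc _ ≤ ∑ _i : Fin N, δ ^ 2 := by
        refine Finset.sum_le_sum fun i _ => ?_
        have h1 := Int.abs_sub_lt_one_of_floor_eq_floor (congrFun h i)
        rw [← sub_div, abs_div, abs_of_pos hδ, div_lt_one hδ] at h1
        rw [Real.norm_eq_abs]
        refine pow_le_pow_left₀ (abs_nonneg _) ?_ 2
        rw [PiLp.sub_apply, abs_sub_comm]; exact h1.le
    _ = _ := by simp

theorem ball_subset_cell {δ : ℝ} (hδ : 0 < δ) (k : Fin N → ℤ) :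
    Metric.ball (WithLp.toLp 2 fun i => δ * (k i + 1 / 2)) (δ / 2) ⊆ cellIndex δ ⁻¹' {k} := by
  intro y hy
  rw [Metric.mem_ball, dist_eq_norm] at hy
  refine funext fun i => ?_
  have h1 := (PiLp.norm_apply_le (y - WithLp.toLp 2 fun i => δ * ((k i : ℝ) + 1 / 2)) i).trans_lt hy
  simp only [PiLp.sub_apply, Real.norm_eq_abs, abs_lt] at h1
  show ⌊y i / δ⌋ = k i
  rw [Int.floor_eq_iff, le_div_iff₀ hδ, div_lt_iff₀ hδ]
  constructor <;> nlinarith [h1.1, h1.2]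

theorem finite_cellIndex_image {K : Set (EuclideanSpace ℝ (Fin N))} (hK : IsCompact K) {δ : ℝ}
    (hδ : 0 < δ) : (cellIndex δ '' K).Finite := by
  obtain ⟨R, hR⟩ := hK.isBounded.exists_norm_le
  refine (Set.finite_Icc (fun _ : Fin N => ⌊-R / δ⌋) (fun _ => ⌊R / δ⌋)).subset ?_
  rintro _ ⟨x, hx, rfl⟩
  have h1 := fun i => abs_le.1 ((PiLp.norm_apply_le x i).trans (hR x hx))
  exact ⟨fun i => Int.floor_mono (by have := (h1 i).1; gcongr),
    fun i => Int.floor_mono (by have := (h1 i).2; gcongr)⟩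

theorem HasWeakGradient.congr_ae {g g' : EuclideanSpace ℝ (Fin N) → ℝ}
    {G : EuclideanSpace ℝ (Fin N) → EuclideanSpace ℝ (Fin N)} (h : HasWeakGradient g G)
    (hg : g =ᵐ[volume] g') : HasWeakGradient g' G := by
  refine ⟨h.memLp.ae_eq hg, h.memLp_grad, fun φ h1 h2 v => ?_⟩
  rw [← h.integral_eq φ h1 h2 v]
  refine integral_congr_ae ?_
  filter_upwards [hg] with x hx
  rw [hx]

theorem volume_cell_ge {δ : ℝ} (hδ : 0 < δ) (k : Fin N → ℤ) :
    ENNReal.ofReal ((δ / 2) ^ N) * volume (Metric.ball (0 : EuclideanSpace ℝ (Fin N)) 1)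
      ≤ volume (cellIndex δ ⁻¹' {k}) := by
  refine le_trans (le_of_eq ?_) (measure_mono (ball_subset_cell hδ k))
  rw [Measure.addHaar_ball_of_pos volume (WithLp.toLp 2 fun i => δ * ((k i : ℝ) + 1 / 2))
    (half_pos hδ)]
  simp

/-- A function of `W^{1,2}(ℝ^N)` with zero mean on every cube of a grid of side `δ` is small in
`L²` with `δ`: its value at `x` is dominated by its variation over the cube containing `x`, hence
by its increments of length at most `√N δ`. -/
theorem HasWeakGradient.integral_sq_le_of_cell_mean_zero
    {g : EuclideanSpace ℝ (Fin N) → ℝ}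
    {G : EuclideanSpace ℝ (Fin N) → EuclideanSpace ℝ (Fin N)} (h : HasWeakGradient g G)
    {δ : ℝ} (hδ : 0 < δ) (hmean : ∀ k, ∫ x in cellIndex δ ⁻¹' {k}, g x = 0) :
    ∫ x, g x ^ 2 ≤ (2 * √N) ^ N * (N * δ ^ 2 * ∫ x, ‖G x‖ ^ 2) := by
  wlog hgm : Measurable g generalizing g
  · have hae := h.memLp.1.ae_eq_mk
    have := this (h.congr_ae hae) (fun k => by
      rw [← hmean k]; exact integral_congr_ae (ae_restrict_of_ae hae.symm))
      h.memLp.1.stronglyMeasurable_mk.measurable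
    refine le_trans (le_of_eq (integral_congr_ae ?_)) this
    filter_upwards [hae] with x hx
    rw [← hx]
  set r := √N * δ with hr
  have hr0 : 0 ≤ r := by positivity
  set β := volume (Metric.ball (0 : EuclideanSpace ℝ (Fin N)) 1) with hβ
  have hβ0 : β ≠ 0 := (Metric.measure_ball_pos _ _ one_pos).ne'
  have hβt : β ≠ ⊤ := measure_ball_lt_top.ne
  set I := ∫ x, ‖G x‖ ^ 2 with hI
  have hI0 : 0 ≤ I := integral_nonneg fun x => sq_nonneg _
  have hpt : ∀ x, ENNReal.ofReal ((δ / 2) ^ N) * β * ENNReal.ofReal (g x ^ 2) ≤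
      ∫⁻ w in Metric.closedBall 0 r, ENNReal.ofReal ((g (x + w) - g x) ^ 2) := by
    intro x
    set Q := cellIndex δ ⁻¹' {cellIndex δ x} with hQ
    have hQm : MeasurableSet Q := measurable_cellIndex δ (measurableSet_singleton _)
    have hQsub : Q ⊆ Metric.closedBall x r := fun y hy => by
      rw [Metric.mem_closedBall, dist_eq_norm]
      exact norm_sub_le_of_cellIndex_eq hδ (by simpa [hQ, eq_comm] using hy)
    have hQt : volume Q ≠ ⊤ := ((measure_mono hQsub).trans_lt measure_closedBall_lt_top).ne
    have : IsFiniteMeasure (volume.restrict Q) := ⟨by simpa using hQt.lt_top⟩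
    have hgQ : MemLp g 2 (volume.restrict Q) := h.memLp.restrict Q
    have hgQ1 : Integrable g (volume.restrict Q) := hgQ.integrable (by norm_num)
    have hdiff : MemLp (fun y => g y - g x) 2 (volume.restrict Q) := hgQ.sub (memLp_const _)
    have e1 : volume.real Q * g x ^ 2 ≤ ∫ y in Q, (g y - g x) ^ 2 := by
      have : ∫ y in Q, (g y - g x) ^ 2
          = (∫ y in Q, g y ^ 2) - 2 * g x * (∫ y in Q, g y) + volume.real Q * g x ^ 2 := by
        have i0 : Integrable (fun y => g y ^ 2 - 2 * g x * g y) (volume.restrict Q) :=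
          hgQ.integrable_sq.sub (hgQ1.const_mul _)
        rw [← integral_const_mul, ← integral_sub hgQ.integrable_sq (hgQ1.const_mul _)]
        have : volume.real Q * g x ^ 2 = ∫ y in Q, g x ^ 2 := by
          rw [setIntegral_const, smul_eq_mul]
        rw [this, ← integral_add i0 (integrable_const _)]
        congr 1; ext y; ring
      rw [this, hmean, mul_zero, sub_zero]
      have : 0 ≤ ∫ y in Q, g y ^ 2 := integral_nonneg fun y => sq_nonneg _
      linarith
    calc _ ≤ volume Q * ENNReal.ofReal (g x ^ 2) := by gcongr; exact volume_cell_ge hδ _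
      _ = ENNReal.ofReal (volume.real Q * g x ^ 2) := by
          rw [ENNReal.ofReal_mul measureReal_nonneg, ofReal_measureReal hQt]
      _ ≤ ENNReal.ofReal (∫ y in Q, (g y - g x) ^ 2) := ENNReal.ofReal_le_ofReal e1
      _ = ∫⁻ y in Q, ENNReal.ofReal ((g y - g x) ^ 2) :=
          ofReal_integral_eq_lintegral_ofReal hdiff.integrable_sq
            (Eventually.of_forall fun y => sq_nonneg _)
      _ ≤ ∫⁻ y in Metric.closedBall x r, ENNReal.ofReal ((g y - g x) ^ 2) :=
          lintegral_mono_set hQsub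
      _ = _ := by
          have := (measurePreserving_add_left volume x).setLIntegral_comp_preimage
            (Metric.isClosed_closedBall (x := x) (ε := r)).measurableSet
            (f := fun y => ENNReal.ofReal ((g y - g x) ^ 2)) (by fun_prop)
          rw [← this]
          congr 2
          ext w; simp
  have hint : ENNReal.ofReal ((δ / 2) ^ N) * β * ENNReal.ofReal (∫ x, g x ^ 2) ≤
      ENNReal.ofReal (r ^ 2 * I) * (ENNReal.ofReal (r ^ N) * β) := by
    rw [ofReal_integral_eq_lintegral_ofReal h.memLp.integrable_sq
      (Eventually.of_forall fun y => sq_nonneg _), ← lintegral_const_mul _ (by fun_prop)]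
    refine (lintegral_mono hpt).trans ?_
    rw [lintegral_lintegral_swap (by fun_prop)]
    have hv : ENNReal.ofReal (r ^ N) * β
        = volume (Metric.closedBall (0 : EuclideanSpace ℝ (Fin N)) r) := by
      rw [Measure.addHaar_closedBall _ _ hr0]; simp [hβ]
    rw [hv, ← setLIntegral_const]
    refine setLIntegral_mono (by fun_prop) fun w hw => ?_
    have hd : MemLp (fun x => g (x + w) - g x) 2 volume :=
      (memLp_translate h.memLp w).sub h.memLp
    rw [← ofReal_integral_eq_lintegral_ofReal hd.integrable_sq
      (Eventually.of_forall fun y => sq_nonneg _)]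
    refine ENNReal.ofReal_le_ofReal ((h.integral_translate_sub_sq_le w).trans ?_)
    have : ‖w‖ ≤ r := by simpa using hw
    gcongr
  have hg0 : 0 ≤ ∫ x, g x ^ 2 := integral_nonneg fun x => sq_nonneg _
  have h3 : ENNReal.ofReal ((δ / 2) ^ N * ∫ x, g x ^ 2) * β
      ≤ ENNReal.ofReal (r ^ 2 * I * r ^ N) * β := by
    rw [ENNReal.ofReal_mul (by positivity), ENNReal.ofReal_mul (by positivity)]
    calc _ = _ := by ring
      _ ≤ _ := hint
      _ = _ := by ring
  have h4 := (ENNReal.ofReal_le_ofReal_iff (by positivity)).1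
    ((ENNReal.mul_le_mul_iff_left hβ0 hβt).1 h3)
  have h5 : (δ / 2) ^ N * ∫ x, g x ^ 2
      ≤ (δ / 2) ^ N * ((2 * √N) ^ N * (N * δ ^ 2 * I)) := by
    refine h4.trans_eq ?_
    have : r ^ N = (δ / 2) ^ N * (2 * √N) ^ N := by
      rw [← mul_pow, hr]; congr 1; ring
    rw [this, hr, mul_pow, Real.sq_sqrt (by positivity)]; ring
  exact le_of_mul_le_mul_left h5 (by positivity)

end

/-! ### Compactness of the embedding of `W^{1,2}(Ω)` into `L²(Ω)` -/

section

variable {N : ℕ} {Ω : Set (EuclideanSpace ℝ (Fin N))}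

theorem exists_isCompact_measureReal_diff_rpow_lt (hΩ : IsOpen Ω) (hfin : volume Ω < ⊤) {θ η : ℝ}
    (hθ : 0 < θ) (hη : 0 < η) :
    ∃ K ⊆ Ω, IsCompact K ∧ volume.real (Ω \ K) ^ θ ≤ η := by
  have hη' : 0 < η ^ θ⁻¹ := Real.rpow_pos_of_pos hη _
  obtain ⟨K, hK, hKc, hKd⟩ := hΩ.measurableSet.exists_isCompact_sdiff_lt hfin.ne
    (ε := ENNReal.ofReal (η ^ θ⁻¹)) (by simpa using hη')
  refine ⟨K, hK, hKc, ?_⟩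
  have : volume.real (Ω \ K) ≤ η ^ θ⁻¹ :=
    ENNReal.toReal_le_of_le_ofReal hη'.le hKd.le
  calc _ ≤ (η ^ θ⁻¹) ^ θ := Real.rpow_le_rpow measureReal_nonneg this hθ.le
    _ = η := Real.rpow_inv_rpow hη.le hθ.ne'

/-- The embedding of `W^{1,2}(Ω)` into `L²(Ω)` has arbitrarily small norm on the common kernel of
finitely many functionals, a form of compactness: near the boundary, this is the Sobolev
inequality; inside, the functionals are the means over the cubes of a fine grid. -/
theorem exists_finset_norm_sq_le_of_inner_eq_zero (hΩ : IsOpen Ω) (hfin : volume Ω < ⊤)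
    {C θ : ℝ} (hC : 0 < C) (hθ : 0 < θ)
    (hS : HasSmallSetBound Ω C θ)
    {ε : ℝ} (hε : 0 < ε) :
    ∃ s : Set (L2 Ω), s.Finite ∧ ∀ (f : L2 Ω) (F : L2Field Ω), IsWeakGradient f F →
      (∀ e ∈ s, ⟪e, f⟫_ℝ = 0) →
      ∫ x in Ω, f x ^ 2 ≤ ε * ((∫ x in Ω, f x ^ 2) + ∫ x in Ω, ‖F x‖ ^ 2) := by
  obtain ⟨K, hKΩ, hK, hKd⟩ := exists_isCompact_measureReal_diff_rpow_lt hΩ hfin hθ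
    (show 0 < ε / (2 * C) by positivity)
  obtain ⟨χ, hχ, hχ1, hχI⟩ := exists_isTestFunction_eq_one hΩ hK hKΩ
  have hχc : Continuous (fderiv ℝ χ) := hχ.1.continuous_fderiv (by norm_num)
  obtain ⟨B, hB⟩ := (hχ.2.1.fderiv ℝ).exists_bound_of_continuous hχc
  have hB0 : 0 ≤ B := (norm_nonneg _).trans (hB 0)
  have hgn : ∀ x, ‖gradient χ x‖ ≤ B := fun x => by
    rw [gradient, LinearIsometryEquiv.norm_map]; exact hB x
  set D : ℝ := (2 * √N) ^ N * N * (2 + 2 * B ^ 2) with hD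
  have hD0 : 0 ≤ D := by positivity
  set δ : ℝ := √(ε / (2 * (D + 1))) with hδ
  have hδ0 : 0 < δ := Real.sqrt_pos.2 (by positivity)
  have hδ2 : D * δ ^ 2 ≤ ε / 2 := by
    rw [hδ, Real.sq_sqrt (by positivity), mul_div_assoc',
      div_le_div_iff₀ (by positivity) (by norm_num)]
    nlinarith
  have hQm : ∀ k, MeasurableSet (cellIndex (N := N) δ ⁻¹' {k}) := fun k =>
    measurable_cellIndex δ (measurableSet_singleton _)
  have hem : ∀ k, MemLp ((cellIndex δ ⁻¹' {k}).indicator χ) 2 (volume.restrict Ω) := fun k =>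
    ((memLp_test hχ.1 hχ.2.1).restrict Ω).indicator (hQm k)
  refine ⟨(fun k => (hem k).toLp) '' (cellIndex δ '' tsupport χ),
    (finite_cellIndex_image hχ.2.1 hδ0).image _, fun f F hf hs => ?_⟩
  set E := (∫ x in Ω, f x ^ 2) + ∫ x in Ω, ‖F x‖ ^ 2 with hE
  have hE0 : 0 ≤ E :=
    add_nonneg (integral_nonneg fun x => sq_nonneg _) (integral_nonneg fun x => sq_nonneg _)
  have hw := hf.hasWeakGradient_cutoff hΩ hχ
  have hcell := hw.integral_sq_le_of_cell_mean_zero hδ0 (fun k => by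
    by_cases hk : k ∈ cellIndex δ '' tsupport χ
    · have h0 := hs _ ⟨k, hk, rfl⟩
      rw [inner_Lp_eq_integral] at h0
      rw [← h0, ← integral_indicator (hQm k), ← integral_indicator hΩ.measurableSet]
      have hae : ∀ᵐ x, x ∈ Ω → ((hem k).toLp : L2 Ω) x = (cellIndex δ ⁻¹' {k}).indicator χ x :=
        (ae_restrict_iff' hΩ.measurableSet).1 (hem k).coeFn_toLp
      refine integral_congr_ae ?_
      filter_upwards [hae] with x hx
      by_cases h1 : x ∈ Ω
      · by_cases h2 : x ∈ cellIndex δ ⁻¹' {k} <;> simp [h1, h2, hx h1]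
      · simp [h1, indicator]
    · refine setIntegral_eq_zero_of_forall_eq_zero fun x hx => ?_
      have : χ x = 0 := by
        by_contra h
        exact hk ⟨x, subset_tsupport _ h, hx⟩
      simp [indicator, this])
  have hfsq := (Lp.memLp f).integrable_sq
  have hFsq := integrable_norm_sq_of_memLp_two (Lp.memLp F)
  -- the cut off function has comparable energy
  have hG : ∫ x, ‖Ω.indicator (fun x => χ x • F x + f x • gradient χ x) x‖ ^ 2
      ≤ (2 + 2 * B ^ 2) * E := by
    have e : ∫ x, ‖Ω.indicator (fun x => χ x • F x + f x • gradient χ x) x‖ ^ 2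
        = ∫ x in Ω, ‖χ x • F x + f x • gradient χ x‖ ^ 2 := by
      rw [← integral_indicator hΩ.measurableSet]
      congr 1; ext x
      by_cases hx : x ∈ Ω <;> simp [hx]
    rw [e]
    have hi : Integrable (fun x => 2 * ‖F x‖ ^ 2 + 2 * B ^ 2 * f x ^ 2) (volume.restrict Ω) :=
      (hFsq.const_mul 2).add (hfsq.const_mul _)
    refine (integral_mono_of_nonneg (Eventually.of_forall fun x => sq_nonneg _) hi
      (Eventually.of_forall fun x => ?_)).trans ?_
    · have h1 : ‖χ x • F x‖ ≤ ‖F x‖ := by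
        rw [norm_smul, Real.norm_eq_abs, abs_of_nonneg (hχI x).1]
        exact mul_le_of_le_one_left (norm_nonneg _) (hχI x).2
      have h2 : ‖f x • gradient χ x‖ ≤ |f x| * B := by
        rw [norm_smul, Real.norm_eq_abs]
        exact mul_le_mul_of_nonneg_left (hgn x) (abs_nonneg _)
      have h3 : ‖χ x • F x + f x • gradient χ x‖ ≤ ‖F x‖ + |f x| * B :=
        (norm_add_le _ _).trans (add_le_add h1 h2)
      calc _ ≤ (‖F x‖ + |f x| * B) ^ 2 := pow_le_pow_left₀ (norm_nonneg _) h3 2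
        _ ≤ 2 * ‖F x‖ ^ 2 + 2 * (|f x| * B) ^ 2 := by nlinarith [sq_nonneg (‖F x‖ - |f x| * B)]
        _ = _ := by rw [mul_pow, sq_abs]; ring
    · rw [integral_add (hFsq.const_mul 2) (hfsq.const_mul _), integral_const_mul,
        integral_const_mul, hE]
      have a1 : 0 ≤ ∫ x in Ω, f x ^ 2 := integral_nonneg fun x => sq_nonneg _
      have a2 : 0 ≤ ∫ x in Ω, ‖F x‖ ^ 2 := integral_nonneg fun x => sq_nonneg _
      nlinarith [mul_nonneg (sq_nonneg B) a2]
  have hin : ∫ x in K, f x ^ 2 ≤ ε / 2 * E := by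
    have e : ∫ x in K, f x ^ 2 ≤ ∫ x, Ω.indicator (fun x => χ x * f x) x ^ 2 := by
      rw [← integral_indicator hK.measurableSet]
      refine integral_mono_of_nonneg (Eventually.of_forall fun x =>
        indicator_nonneg (fun _ _ => sq_nonneg _) x) hw.memLp.integrable_sq
        (Eventually.of_forall fun x => ?_)
      by_cases hx : x ∈ K
      · simp [hx, hKΩ hx, hχ1.self_of_nhdsSet x hx]
      · simp only [indicator_of_notMem hx]; positivity
    refine e.trans (hcell.trans ?_)
    calc _ ≤ (2 * √N) ^ N * (N * δ ^ 2 * ((2 + 2 * B ^ 2) * E)) := by gcongr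
      _ = D * δ ^ 2 * E := by rw [hD]; ring
      _ ≤ _ := by gcongr
  have hout : ∫ x in Ω \ K, f x ^ 2 ≤ ε / 2 * E := by
    refine (hS f F hf _ sdiff_subset (hΩ.measurableSet.diff hK.measurableSet)).trans ?_
    calc _ ≤ C * (ε / (2 * C)) * E := by gcongr
      _ = _ := by field_simp
  have hsplit := setIntegral_sdiff hK.measurableSet (f := fun x => f x ^ 2) hfsq hKΩ
  linarith

end

/-! ### Compact operators and sorted eigenbases -/

section

variable {V H : Type*} [NormedAddCommGroup V] [InnerProductSpace ℝ V]
  [NormedAddCommGroup H] [InnerProductSpace ℝ H]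

theorem isCompactOperator_of_finiteDimensional {U : Type*} [NormedAddCommGroup U]
    [InnerProductSpace ℝ U] [FiniteDimensional ℝ U] (T : U →L[ℝ] H) : IsCompactOperator T := by
  have h : IsCompactOperator (id : U → U) := isCompactOperator_id_iff_finiteDimensional.2 ‹_›
  exact h.clm_comp T

/-- An operator between Hilbert spaces which is small on the common kernel of finitely many
functionals is compact, being close to an operator of finite rank. -/
theorem isCompactOperator_of_forall_finite [CompleteSpace V] [CompleteSpace H]
    (T : V →L[ℝ] H)
    (h : ∀ ε : ℝ, 0 < ε → ∃ s : Set H, s.Finite ∧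
      ∀ w, (∀ e ∈ s, ⟪e, T w⟫_ℝ = 0) → ‖T w‖ ^ 2 ≤ ε * ‖w‖ ^ 2) : IsCompactOperator T := by
  have hcl := isClosed_setOfPred_isCompactOperator (σ₁₂ := RingHom.id ℝ) (M₁ := V) (M₂ := H)
  have hmem : T ∈ closure {f : V →L[ℝ] H | IsCompactOperator f} := by
    rw [Metric.mem_closure_iff]
    intro ε hε
    obtain ⟨s, hs, hsT⟩ := h ((ε / 2) ^ 2) (by positivity)
    set U : Submodule ℝ V := Submodule.span ℝ (T.adjoint '' s) with hU
    have : FiniteDimensional ℝ U := FiniteDimensional.span_of_finite ℝ (hs.image _)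
    refine ⟨(T ∘L U.subtypeL) ∘L U.orthogonalProjectionOnto, ?_, ?_⟩
    · exact (isCompactOperator_of_finiteDimensional (T ∘L U.subtypeL)).comp_clm _
    · rw [dist_eq_norm]
      refine lt_of_le_of_lt (ContinuousLinearMap.opNorm_le_bound _ (half_pos hε).le fun w => ?_)
        (half_lt_self hε)
      set p : V := w - U.starProjection w with hp
      have hpU : p ∈ Uᗮ := U.sub_starProjection_mem_orthogonal w
      have e : (T - (T ∘L U.subtypeL) ∘L U.orthogonalProjectionOnto) w = T p := by
        simp [hp]
      have hpn : ‖p‖ ≤ ‖w‖ := by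
        have : p = Uᗮ.starProjection w := by
          rw [Submodule.starProjection_orthogonal_val]
        rw [this]
        exact Submodule.norm_starProjection_apply_le _ _
      have h1 := hsT p (fun e he => by
        rw [← ContinuousLinearMap.adjoint_inner_left]
        exact hpU _ (Submodule.subset_span ⟨e, he, rfl⟩))
      rw [e]
      refine (abs_le_of_sq_le_sq' (b := ε / 2 * ‖p‖) (by rwa [mul_pow]) (by positivity)).2.trans ?_
      gcongr
  exact hcl.closure_subset hmem

/-- A function on an infinite type with finite sublevel sets can be sorted into an increasing
sequence. -/
theorem exists_equiv_monotone_of_finite_sublevel {ι : Type*} [Infinite ι] (a : ι → ℝ)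
    (h : ∀ c, {i | a i ≤ c}.Finite) : ∃ e : ℕ ≃ ι, Monotone (a ∘ e) := by
  classical
  have : Countable ι := by
    have hu : (⋃ n : ℕ, {i | a i ≤ n}) = univ := by
      ext i
      simpa using exists_nat_ge (a i)
    rw [← Set.countable_univ_iff, ← hu]
    exact Set.countable_iUnion fun n => (h n).countable
  obtain ⟨c, hc⟩ := exists_injective_nat ι
  -- ties are broken by an enumeration of the countable index type
  let key : ι → ℝ ×ₗ ℕ := fun i => toLex (a i, c i)
  have hkey : Function.Injective key := fun i j hij => hc (by
    have := congrArg (fun x => (ofLex x).2) hij; exact this)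
  have hle : ∀ {i j}, key i ≤ key j → a i ≤ a j := by
    intro i j hij
    rcases (Prod.Lex.toLex_le_toLex).1 hij with h1 | h1
    · exact h1.le
    · exact h1.1.le
  have hfin : ∀ i, {j | key j < key i}.Finite := fun i =>
    (h (a i)).subset fun j hj => hle (le_of_lt hj)
  -- the rank of an index is the number of its predecessors
  let r : ι → ℕ := fun i => (hfin i).toFinset.card
  have hr : ∀ {i j}, key i < key j → r i < r j := by
    intro i j hij
    refine Finset.card_lt_card (Finset.ssubset_iff_of_subset ?_ |>.2 ⟨i, ?_, ?_⟩)
    · intro k hk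
      simp only [Finite.mem_toFinset, mem_ofPred_eq] at hk ⊢
      exact hk.trans hij
    · simpa using hij
    · simp
  have hri : Function.Injective r := by
    intro i j hij
    by_contra hne
    rcases lt_or_gt_of_ne (hkey.ne hne) with h1 | h1
    · exact (hr h1).ne hij
    · exact (hr h1).ne' hij
  have hrs : Function.Surjective r := by
    intro m
    obtain ⟨i, hi⟩ : ∃ i, m < r i := by
      by_contra! hcon
      exact (Set.infinite_range_of_injective hri)
        ((Set.finite_Iic m).subset (by rintro _ ⟨i, rfl⟩; exact hcon i))
    have := Finset.surj_on_of_inj_on_of_card_le (s := (hfin i).toFinset) (t := Finset.range (r i))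
      (fun j _ => r j) (fun j hj => by simpa using hr (by simpa using hj))
      (fun _ _ _ _ hij => hri hij) (by simp [r]) m (by simpa using hi)
    obtain ⟨j, -, hj⟩ := this
    exact ⟨j, hj.symm⟩
  refine ⟨(Equiv.ofBijective r ⟨hri, hrs⟩).symm, fun m n hmn => ?_⟩
  refine hle ?_
  by_contra! hlt
  have := hr hlt
  have e : ∀ k, r ((Equiv.ofBijective r ⟨hri, hrs⟩).symm k) = k := fun k =>
    (Equiv.ofBijective r ⟨hri, hrs⟩).apply_symm_apply k
  rw [e, e] at this
  omega

/-- Only finitely many members of an orthonormal family of eigenvectors of a compact operator have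
an eigenvalue above a given positive level. -/
theorem IsCompactOperator.finite_setOf_le_eigenvalue {K : H →L[ℝ] H} (hK : IsCompactOperator K)
    {ι : Type*} {v : ι → H} (hv : Orthonormal ℝ v) {κ : ι → ℝ} (hKv : ∀ i, K (v i) = κ i • v i)
    {ε : ℝ} (hε : 0 < ε) : {i | ε ≤ κ i}.Finite := by
  by_contra hinf
  obtain ⟨f, hf⟩ : ∃ f : ℕ → ι, Function.Injective f ∧ ∀ n, ε ≤ κ (f n) :=
    let g := Set.Infinite.natEmbedding _ hinf
    ⟨fun n => g n, fun m n h => g.injective (Subtype.ext h), fun n => (g n).2⟩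
  obtain ⟨S, hS, hSK⟩ := hK.image_closedBall_subset_compact 1
  have hmem : ∀ n, K (v (f n)) ∈ S := fun n => hSK ⟨v (f n), by simp [hv.1], rfl⟩
  obtain ⟨x, -, φ, hφ, hlim⟩ := hS.tendsto_subseq hmem
  obtain ⟨n₀, hn₀⟩ := Metric.cauchySeq_iff.1 hlim.cauchySeq ε hε
  have h1 := hn₀ n₀ le_rfl (n₀ + 1) (by omega)
  set i := f (φ n₀)
  set j := f (φ (n₀ + 1))
  have hij : i ≠ j := fun h => by
    have := hφ.injective (hf.1 h); omega
  have h2 : dist (K (v i)) (K (v j)) ^ 2 = κ i ^ 2 + κ j ^ 2 := by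
    rw [dist_eq_norm, hKv, hKv, norm_sub_sq_real, norm_smul, norm_smul, hv.1, hv.1,
      real_inner_smul_left, real_inner_smul_right, hv.2 hij]
    simp
  have h3 : dist (K (v i)) (K (v j)) ^ 2 < ε ^ 2 := pow_lt_pow_left₀ h1 dist_nonneg (by norm_num)
  have h4 : ε ^ 2 ≤ κ i ^ 2 := pow_le_pow_left₀ hε.le (hf.2 _) 2
  nlinarith [sq_nonneg (κ j)]

/-- The spectral theorem for an injective positive compact operator on an infinite-dimensional
space, in the form of a Hilbert basis along which the inverses of the eigenvalues increase to
infinity. -/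
theorem IsCompactOperator.exists_hilbertBasis_nat [CompleteSpace H] {K : H →L[ℝ] H}
    (hK : IsCompactOperator K) (hsymm : K.IsSymmetric) (hpos : ∀ f, f ≠ 0 → 0 < ⟪K f, f⟫_ℝ)
    (hinf : ¬ FiniteDimensional ℝ H) :
    ∃ (b : HilbertBasis ℕ ℝ H) (a : ℕ → ℝ), Monotone a ∧ Tendsto a atTop atTop ∧
      (∀ n, 0 < a n) ∧ ∀ n, b n = a n • K (b n) := by
  have hbot : Module.End.eigenspace (K : Module.End ℝ H) 0 = ⊥ := by
    rw [Submodule.eq_bot_iff]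
    intro x hx
    rw [Module.End.mem_eigenspace_iff] at hx
    by_contra h0
    have := hpos x h0
    simp only [ContinuousLinearMap.coe_coe, zero_smul] at hx
    simp [hx] at this
  have hfd : ∀ μ : ℝ, FiniteDimensional ℝ (Module.End.eigenspace (K : Module.End ℝ H) μ) := by
    intro μ
    rcases eq_or_ne μ 0 with rfl | hμ
    · rw [hbot]; infer_instance
    · exact K.finite_dimensional_eigenspace hK μ hμ
  let w : ∀ μ : ℝ, _ := fun μ =>
    stdOrthonormalBasis ℝ (Module.End.eigenspace (K : Module.End ℝ H) μ)
  let ι := Σ μ : ℝ, Fin (Module.finrank ℝ (Module.End.eigenspace (K : Module.End ℝ H) μ))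
  let v : ι → H := fun i => (w i.1 i.2 : H)
  have hv : Orthonormal ℝ v :=
    hsymm.orthogonalFamily_eigenspaces.orthonormal_sigma_orthonormal fun μ => (w μ).orthonormal
  have hKv : ∀ i, K (v i) = i.1 • v i := fun i =>
    Module.End.mem_eigenspace_iff.1 (w i.1 i.2).2
  have hμ0 : ∀ i : ι, 0 < i.1 := by
    intro i
    have := hpos (v i) (hv.ne_zero i)
    rw [hKv, real_inner_smul_left, real_inner_self_eq_norm_sq, hv.1] at this
    simpa using this
  have hspan : (Submodule.span ℝ (Set.range v))ᗮ = ⊥ := by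
    rw [eq_bot_iff, ← K.orthogonalComplement_iSup_eigenspaces_eq_bot hK hsymm]
    refine Submodule.orthogonal_le (iSup_le fun μ => ?_)
    have h1 : Module.End.eigenspace (K : Module.End ℝ H) μ
        = Submodule.span ℝ (Set.range fun k => ((w μ k : _) : H)) := by
      have := (w μ).toBasis.span_eq
      have h2 := congrArg (Submodule.map (Submodule.subtype _)) this
      rw [Submodule.map_span, Submodule.map_top, Submodule.range_subtype, ← Set.range_comp] at h2
      refine h2.symm.trans (congrArg (fun s => Submodule.span ℝ (Set.range s)) ?_)
      ext k; simp
    rw [h1]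
    exact Submodule.span_mono (by rintro _ ⟨k, rfl⟩; exact ⟨⟨μ, k⟩, rfl⟩)
  have hι : Infinite ι := by
    by_contra hfin
    rw [not_infinite_iff_finite] at hfin
    have := Fintype.ofFinite ι
    let b := (HilbertBasis.mkOfOrthogonalEqBot hv hspan).toOrthonormalBasis
    exact hinf b.toBasis.finiteDimensional_of_finite
  have hlev : ∀ c : ℝ, {i : ι | (i.1)⁻¹ ≤ c}.Finite := by
    intro c
    refine (hK.finite_setOf_le_eigenvalue hv hKv (ε := (max c 1)⁻¹) (by positivity)).subset ?_
    intro i hi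
    rw [mem_ofPred_eq, inv_le_comm₀ (by positivity) (hμ0 i)]
    exact le_max_of_le_left hi
  obtain ⟨e, he⟩ := exists_equiv_monotone_of_finite_sublevel (fun i : ι => (i.1)⁻¹) hlev
  refine ⟨HilbertBasis.mkOfOrthogonalEqBot (v := v ∘ e) (hv.comp e e.injective)
    (by rw [e.surjective.range_comp]; exact hspan), fun n => ((e n).1)⁻¹, he, ?_, ?_, ?_⟩
  · rw [← Nat.cofinite_eq_atTop, tendsto_atTop]
    intro c
    refine ((hlev c).preimage e.injective.injOn).subset fun n hn => ?_
    have hn' : ¬ c ≤ ((e n).1)⁻¹ := hn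
    exact (not_le.1 hn').le
  · exact fun n => inv_pos.2 (hμ0 _)
  · intro n
    rw [HilbertBasis.coe_mkOfOrthogonalEqBot, Function.comp_apply, hKv, smul_smul,
      inv_mul_cancel₀ (hμ0 _).ne', one_smul]

end

/-! ### Discreteness of the spectrum -/

section

variable {N : ℕ} {Ω : Set (EuclideanSpace ℝ (Fin N))}

theorem IsTestFunction.memLp {φ : EuclideanSpace ℝ (Fin N) → ℝ} (hφ : IsTestFunction Ω φ) :
    MemLp φ 2 (volume.restrict Ω) := (memLp_test hφ.1 hφ.2.1).restrict Ω

theorem IsTestFunction.memLp_fderiv {φ : EuclideanSpace ℝ (Fin N) → ℝ} (hφ : IsTestFunction Ω φ)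
    (v : EuclideanSpace ℝ (Fin N)) : MemLp (fun x => fderiv ℝ φ x v) 2 (volume.restrict Ω) := by
  have hc : Continuous fun x => fderiv ℝ φ x v :=
    (hφ.1.continuous_fderiv (by norm_num)).clm_apply continuous_const
  exact hc.memLp_of_hasCompactSupport (hφ.2.1.fderiv_apply ℝ v)

theorem IsTestFunction.memLp_gradient {φ : EuclideanSpace ℝ (Fin N) → ℝ}
    (hφ : IsTestFunction Ω φ) : MemLp (gradient φ) 2 (volume.restrict Ω) := by
  have hc : Continuous (gradient φ) :=
    (InnerProductSpace.toDual ℝ _).symm.continuous.comp (hφ.1.continuous_fderiv (by norm_num))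
  refine hc.memLp_of_hasCompactSupport ((hφ.2.1.fderiv ℝ).comp_left ?_)
  exact map_zero _

/-- A test function has a weak gradient, its classical one. -/
theorem IsTestFunction.isWeakGradient {φ : EuclideanSpace ℝ (Fin N) → ℝ}
    (hφ : IsTestFunction Ω φ) :
    IsWeakGradient (hφ.memLp.toLp : L2 Ω) (hφ.memLp_gradient.toLp : L2Field Ω) := by
  intro η hη v
  have e1 : ∫ x in Ω, (hφ.memLp.toLp : L2 Ω) x * fderiv ℝ η x v
      = ∫ x in Ω, φ x * fderiv ℝ η x v := by
    refine integral_congr_ae ?_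
    filter_upwards [hφ.memLp.coeFn_toLp] with x hx
    rw [hx]
  have e2 : ∫ x in Ω, ⟪(hφ.memLp_gradient.toLp : L2Field Ω) x, v⟫_ℝ * η x
      = ∫ x in Ω, fderiv ℝ φ x v * η x := by
    refine integral_congr_ae ?_
    filter_upwards [hφ.memLp_gradient.coeFn_toLp] with x hx
    rw [hx, inner_gradient_left]
  have z1 : ∀ x ∉ Ω, φ x = 0 := fun x hx =>
    image_eq_zero_of_notMem_tsupport fun h => hx (hφ.2.2 h)
  have z2 : ∀ x ∉ Ω, η x = 0 := fun x hx =>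
    image_eq_zero_of_notMem_tsupport fun h => hx (hη.2.2 h)
  rw [e1, e2, setIntegral_eq_integral_of_forall_compl_eq_zero fun x hx => by
    rw [z1 x hx, zero_mul], setIntegral_eq_integral_of_forall_compl_eq_zero fun x hx => by
    rw [z2 x hx, mul_zero]]
  have hφ' : IsTestFunction univ φ := ⟨hφ.1, hφ.2.1, subset_univ _⟩
  have hη' : IsTestFunction univ η := ⟨hη.1, hη.2.1, subset_univ _⟩
  have m1 := hφ'.memLp
  have m2 := hη'.memLp
  have m3 := hφ'.memLp_fderiv v
  have m4 := hη'.memLp_fderiv v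
  rw [Measure.restrict_univ] at m1 m2 m3 m4
  exact integral_mul_fderiv_eq_neg_fderiv_mul_of_integrable
    (integrable_mul_of_memLp_two m3 m2) (integrable_mul_of_memLp_two m1 m4)
    (integrable_mul_of_memLp_two m1 m2) (fun x _ => hφ.1.differentiable (by norm_num) x)
    (fun x _ => hη.1.differentiable (by norm_num) x)

theorem eq_zero_of_forall_inner_test_eq_zero (hΩ : IsOpen Ω) {f : L2 Ω}
    (h : ∀ (φ : EuclideanSpace ℝ (Fin N) → ℝ) (hφ : IsTestFunction Ω φ),
      ⟪f, (hφ.memLp.toLp : L2 Ω)⟫_ℝ = 0) : f = 0 := by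
  have h0 : ∀ᵐ x ∂volume, x ∈ Ω → f x = 0 := by
    refine hΩ.ae_eq_zero_of_integral_contDiff_smul_eq_zero
      (locallyIntegrableOn_of_locallyIntegrable_restrict
        ((Lp.memLp f).locallyIntegrable (by norm_num))) fun φ h1 h2 h3 => ?_
    have hφ : IsTestFunction Ω φ := ⟨h1, h2, h3⟩
    have := h φ hφ
    rw [inner_Lp_eq_integral] at this
    rw [← setIntegral_eq_integral_of_forall_compl_eq_zero (s := Ω) fun x hx => by
      rw [image_eq_zero_of_notMem_tsupport fun h => hx (h3 h), zero_smul], ← this]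
    refine integral_congr_ae ?_
    filter_upwards [hφ.memLp.coeFn_toLp] with x hx
    rw [hx, smul_eq_mul, mul_comm]
  apply Lp.ext
  refine EventuallyEq.trans ?_ (Lp.coeFn_zero _ _ _).symm
  rw [Filter.EventuallyEq, ae_restrict_iff' hΩ.measurableSet]
  exact h0

/-- The integration by parts identity against a given test function is an orthogonality relation
in `L²(Ω) × L²(Ω; ℝ^N)`. -/
theorem IsTestFunction.exists_forall_integral_eq_iff {φ : EuclideanSpace ℝ (Fin N) → ℝ}
    (hφ : IsTestFunction Ω φ) (v : EuclideanSpace ℝ (Fin N)) :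
    ∃ (a : L2 Ω) (b : L2Field Ω), ∀ (f : L2 Ω) (F : L2Field Ω),
      (∫ x in Ω, f x * fderiv ℝ φ x v = - ∫ x in Ω, ⟪F x, v⟫_ℝ * φ x) ↔
        ⟪a, f⟫_ℝ + ⟪b, F⟫_ℝ = 0 := by
  have ha := hφ.memLp_fderiv v
  have hb : MemLp (fun x => φ x • v) 2 (volume.restrict Ω) :=
    hφ.memLp.of_le_mul (c := ‖v‖) (hφ.memLp.1.smul_const v)
      (Eventually.of_forall fun x => by rw [norm_smul, mul_comm])
  refine ⟨ha.toLp, hb.toLp, fun f F => ?_⟩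
  have e1 : ⟪(ha.toLp : L2 Ω), f⟫_ℝ = ∫ x in Ω, f x * fderiv ℝ φ x v := by
    rw [inner_Lp_eq_integral]
    refine integral_congr_ae ?_
    filter_upwards [ha.coeFn_toLp] with x hx
    rw [hx, mul_comm]
  have e2 : ⟪(hb.toLp : L2Field Ω), F⟫_ℝ = ∫ x in Ω, ⟪F x, v⟫_ℝ * φ x := by
    rw [L2.inner_def]
    refine integral_congr_ae ?_
    filter_upwards [hb.coeFn_toLp] with x hx
    rw [hx, real_inner_smul_left, real_inner_comm, mul_comm]
  rw [e1, e2, eq_neg_iff_add_eq_zero]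

variable (Ω) in
/-- The space `W^{1,2}(Ω)`, encoded as the graph of the weak gradient in
`L²(Ω) × L²(Ω; ℝ^N)`; it inherits the inner product of `W^{1,2}(Ω)`. -/
noncomputable def weakGradientGraph : Submodule ℝ (WithLp 2 (L2 Ω × L2Field Ω)) where
  carrier := {p | IsWeakGradient p.fst p.snd}
  add_mem' {p q} hp hq φ hφ v := by
    obtain ⟨a, b, hab⟩ := hφ.exists_forall_integral_eq_iff v
    have h1 := (hab _ _).1 (hp φ hφ v)
    have h2 := (hab _ _).1 (hq φ hφ v)
    rw [hab, WithLp.add_fst, WithLp.add_snd, inner_add_right, inner_add_right]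
    linarith
  zero_mem' φ hφ v := by
    obtain ⟨a, b, hab⟩ := hφ.exists_forall_integral_eq_iff v
    rw [hab]; simp
  smul_mem' c p hp φ hφ v := by
    obtain ⟨a, b, hab⟩ := hφ.exists_forall_integral_eq_iff v
    have h1 := (hab _ _).1 (hp φ hφ v)
    rw [hab, WithLp.smul_fst, WithLp.smul_snd, real_inner_smul_right, real_inner_smul_right,
      ← mul_add, h1, mul_zero]

theorem mem_weakGradientGraph {p : WithLp 2 (L2 Ω × L2Field Ω)} :
    p ∈ weakGradientGraph Ω ↔ IsWeakGradient p.fst p.snd := Iff.rfl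

theorem isClosed_weakGradientGraph :
    IsClosed (weakGradientGraph Ω : Set (WithLp 2 (L2 Ω × L2Field Ω))) := by
  have : (weakGradientGraph Ω : Set (WithLp 2 (L2 Ω × L2Field Ω))) =
      ⋂ (φ) (_ : IsTestFunction Ω φ) (v : EuclideanSpace ℝ (Fin N)),
        {p | ∫ x in Ω, p.fst x * fderiv ℝ φ x v = - ∫ x in Ω, ⟪p.snd x, v⟫_ℝ * φ x} := by
    ext p; simp only [mem_iInter]; rfl
  rw [this]
  refine isClosed_iInter fun φ => isClosed_iInter fun hφ => isClosed_iInter fun v => ?_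
  obtain ⟨a, b, hab⟩ := hφ.exists_forall_integral_eq_iff v
  simp only [hab]
  have h1 : Continuous fun p : WithLp 2 (L2 Ω × L2Field Ω) => p.fst :=
    (WithLp.fstL 2 ℝ (L2 Ω) (L2Field Ω)).continuous
  have h2 : Continuous fun p : WithLp 2 (L2 Ω × L2Field Ω) => p.snd :=
    (WithLp.sndL 2 ℝ (L2 Ω) (L2Field Ω)).continuous
  exact isClosed_eq ((continuous_const.inner h1).add (continuous_const.inner h2)) continuous_const

instance : CompleteSpace (weakGradientGraph Ω) := isClosed_weakGradientGraph.completeSpace_coe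

theorem norm_L2Field_sq_eq_integral (F : L2Field Ω) : ‖F‖ ^ 2 = ∫ x in Ω, ‖F x‖ ^ 2 := by
  rw [← real_inner_self_eq_norm_sq, L2.inner_def]
  simp

/-- The space `L²(Ω)` over a nonempty open set in dimension at least one is
infinite-dimensional: it contains the indicators of a sequence of disjoint
open sets. -/
theorem not_finiteDimensional_L2 (hN : 1 ≤ N) (hΩ : IsOpen Ω) (hne : Ω.Nonempty)
    (hfin : volume Ω < ⊤) : ¬ FiniteDimensional ℝ (L2 Ω) := by
  intro hfd
  have : Nonempty (Fin N) := ⟨⟨0, hN⟩⟩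
  have hinf : Infinite Ω := by
    refine Set.infinite_coe_iff.2 fun hf => ?_
    have h0 := hf.measure_zero (volume : Measure (EuclideanSpace ℝ (Fin N)))
    exact (hΩ.measure_pos volume hne).ne' h0
  obtain ⟨U, hUi, hUo, hUd⟩ := exists_seq_infinite_isOpen_pairwise_disjoint Ω
  set A : ℕ → Set (EuclideanSpace ℝ (Fin N)) := fun n => Subtype.val '' U n with hA
  have hAo : ∀ n, IsOpen (A n) := fun n => hΩ.isOpenMap_subtype_val _ (hUo n)
  have hAΩ : ∀ n, A n ⊆ Ω := fun n => by rintro _ ⟨x, -, rfl⟩; exact x.2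
  have hApos : ∀ n, volume.restrict Ω (A n) ≠ 0 := fun n => by
    rw [Measure.restrict_apply (hAo n).measurableSet, inter_eq_left.2 (hAΩ n)]
    exact ((hAo n).measure_pos volume ((hUi n).nonempty.image _)).ne'
  have hAfin : ∀ n, volume.restrict Ω (A n) ≠ ⊤ := fun n =>
    (((Measure.restrict_apply_le _ _).trans (measure_mono (hAΩ n))).trans_lt hfin).ne
  have hAd : ∀ m n, m ≠ n → A m ∩ A n = ∅ := fun m n hmn => by
    rw [← disjoint_iff_inter_eq_empty]
    exact (disjoint_image_iff Subtype.val_injective).2 (hUd hmn)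
  let e : ℕ → L2 Ω := fun n => indicatorConstLp 2 (hAo n).measurableSet (hAfin n) (1 : ℝ)
  have hli : LinearIndependent ℝ e := by
    refine linearIndependent_of_ne_zero_of_inner_eq_zero (𝕜 := ℝ) (fun n h0 => ?_) fun m n hmn => ?_
    · have h1 := norm_indicatorConstLp (p := 2) (hs := (hAo n).measurableSet) (hμs := hAfin n)
        (c := (1 : ℝ)) (by norm_num) (by norm_num)
      have h2 : ‖e n‖ = 0 := by rw [h0, norm_zero]
      rw [h2] at h1
      have h3 : 0 < (volume.restrict Ω).real (A n) := ENNReal.toReal_pos (hApos n) (hAfin n)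
      have h4 := Real.rpow_pos_of_pos h3 (1 / (2 : ℝ≥0∞).toReal)
      rw [norm_one, one_mul] at h1
      exact h4.ne h1
    · show ⟪indicatorConstLp 2 (hAo m).measurableSet (hAfin m) (1 : ℝ), e n⟫_ℝ = 0
      rw [L2.inner_indicatorConstLp_one]
      rw [setIntegral_congr_ae (g := fun _ => (0 : ℝ)) (hAo m).measurableSet]
      · simp
      · filter_upwards [indicatorConstLp_coeFn (p := 2) (hs := (hAo n).measurableSet)
          (hμs := hAfin n) (c := (1 : ℝ))] with x hx hxm
        rw [hx, indicator_of_notMem]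
        intro hxn
        have : x ∈ A m ∩ A n := ⟨hxm, hxn⟩
        simp [hAd m n hmn] at this
  exact not_finite_iff_infinite.2 inferInstance hli.finite

/-- Under the compactness estimate for `W^{1,2}(Ω)` the Neumann Laplacian has discrete spectrum:
its resolvent at `-1` is `T T*`, where `T` embeds `W^{1,2}(Ω)` into `L²(Ω)`. -/
theorem exists_isNeumannEigenvalueSequence (hΩ : IsOpen Ω) (hinf : ¬ FiniteDimensional ℝ (L2 Ω))
    (h : ∀ ε : ℝ, 0 < ε → ∃ s : Set (L2 Ω), s.Finite ∧
      ∀ (f : L2 Ω) (F : L2Field Ω), IsWeakGradient f F → (∀ e ∈ s, ⟪e, f⟫_ℝ = 0) →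
      ∫ x in Ω, f x ^ 2 ≤ ε * ((∫ x in Ω, f x ^ 2) + ∫ x in Ω, ‖F x‖ ^ 2)) :
    ∃ lam : ℕ → ℝ, IsNeumannEigenvalueSequence Ω lam := by
  set T : weakGradientGraph Ω →L[ℝ] L2 Ω :=
    (WithLp.fstL 2 ℝ (L2 Ω) (L2Field Ω)) ∘L (weakGradientGraph Ω).subtypeL with hT
  have hTapp : ∀ w : weakGradientGraph Ω, T w = w.1.fst := fun w => rfl
  have hTc : IsCompactOperator T := by
    refine isCompactOperator_of_forall_finite T fun ε hε => ?_
    obtain ⟨s, hs, hs'⟩ := h ε hε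
    refine ⟨s, hs, fun w hw => ?_⟩
    have := hs' _ _ w.2 hw
    rw [hTapp, Submodule.coe_norm, WithLp.prod_norm_sq_eq_of_L2, norm_Lp_sq_eq_integral,
      norm_L2Field_sq_eq_integral]
    exact this
  set K : L2 Ω →L[ℝ] L2 Ω := T ∘L T.adjoint with hK
  have hKc : IsCompactOperator K := hTc.comp_clm _
  have hKs : (K : L2 Ω →ₗ[ℝ] L2 Ω).IsSymmetric := by
    intro f g
    show ⟪T (T.adjoint f), g⟫_ℝ = ⟪f, T (T.adjoint g)⟫_ℝ
    rw [← ContinuousLinearMap.adjoint_inner_right, ContinuousLinearMap.adjoint_inner_left]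
  have hKp : ∀ f, f ≠ 0 → 0 < ⟪K f, f⟫_ℝ := by
    intro f hf
    show 0 < ⟪T (T.adjoint f), f⟫_ℝ
    rw [← ContinuousLinearMap.adjoint_inner_right, real_inner_self_eq_norm_sq]
    refine pow_pos (norm_pos_iff.2 fun h0 => hf ?_) 2
    refine eq_zero_of_forall_inner_test_eq_zero hΩ fun φ hφ => ?_
    have := ContinuousLinearMap.adjoint_inner_left T
      ⟨WithLp.toLp 2 (hφ.memLp.toLp, hφ.memLp_gradient.toLp), hφ.isWeakGradient⟩ f
    rw [h0, inner_zero_left] at this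
    exact this.symm
  obtain ⟨b, a, ha1, ha2, ha3, ha4⟩ := hKc.exists_hilbertBasis_nat hKs hKp hinf
  refine ⟨fun n => a n - 1, fun m n hmn => sub_le_sub_right (ha1 hmn) 1,
    tendsto_atTop_add_const_right _ (-1) ha2, b, fun n => ?_⟩
  obtain ⟨t, ht⟩ : ∃ t, T.adjoint (b n) = t := ⟨_, rfl⟩
  have ht1 : b n = a n • t.1.fst := by rw [← hTapp, ← ht]; exact ha4 n
  have ht2 : IsWeakGradient (a n • t.1.fst) (a n • t.1.snd) :=
    (weakGradientGraph Ω).smul_mem (a n) t.2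
  refine ⟨a n • t.1.snd, ht1 ▸ ht2, fun g G hg => ?_⟩
  obtain ⟨p, hp⟩ : ∃ p : weakGradientGraph Ω, p.1 = WithLp.toLp 2 (g, G) :=
    ⟨⟨WithLp.toLp 2 (g, G), mem_weakGradientGraph.2 hg⟩, rfl⟩
  have h1 : ⟪t, p⟫_ℝ = ⟪b n, g⟫_ℝ := by
    rw [← ht, ContinuousLinearMap.adjoint_inner_left, hTapp, hp]; rfl
  rw [Submodule.coe_inner, WithLp.prod_inner_apply, hp] at h1
  change ⟪t.1.fst, g⟫_ℝ + ⟪t.1.snd, G⟫_ℝ = _ at h1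
  have h2 : ⟪b n, g⟫_ℝ = a n * ⟪t.1.fst, g⟫_ℝ := by rw [ht1, real_inner_smul_left]
  have h3 : ∫ x in Ω, ((a n - 1) • b n : L2 Ω) x * g x = ⟪(a n - 1) • b n, g⟫_ℝ :=
    (inner_Lp_eq_integral _ _).symm
  rw [h3, real_inner_smul_left, ← L2.inner_def, real_inner_smul_left, ← h1, mul_add]
  rw [← h1] at h2
  linear_combination h2

end

/-! ### Boundedness of eigenfunctions -/

/-- A `C^{1,1}` version of `t ↦ (t - k)₊`: zero up to `k`, of slope one beyond `k + h`, and
quadratic in between. -/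
noncomputable def softTruncation (k h t : ℝ) : ℝ :=
  (max (t - k) 0 ^ 2 - max (t - k - h) 0 ^ 2) / (2 * h)

/-- The derivative of `softTruncation k h`. -/
noncomputable def softTruncationDeriv (k h t : ℝ) : ℝ :=
  (max (t - k) 0 - max (t - k - h) 0) / h

section SoftTruncation

variable {k h : ℝ}

theorem softTruncationDeriv_nonneg (hh : 0 < h) (t : ℝ) : 0 ≤ softTruncationDeriv k h t := by
  refine div_nonneg (sub_nonneg.2 (max_le_max_right 0 ?_)) hh.le
  linarith

theorem softTruncationDeriv_le_one (hh : 0 < h) (t : ℝ) : softTruncationDeriv k h t ≤ 1 := by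
  rw [softTruncationDeriv, div_le_one hh]
  rcases max_cases (t - k) 0 with h1 | h1 <;> rcases max_cases (t - k - h) 0 with h2 | h2 <;>
    linarith

theorem posPart_sq_taylor (a b : ℝ) :
    0 ≤ max b 0 ^ 2 - max a 0 ^ 2 - 2 * max a 0 * (b - a) ∧
      max b 0 ^ 2 - max a 0 ^ 2 - 2 * max a 0 * (b - a) ≤ (b - a) ^ 2 := by
  rcases max_cases a 0 with h1 | h1 <;> rcases max_cases b 0 with h2 | h2 <;> rw [h1.1, h2.1] <;>
    constructor <;> nlinarith [sq_nonneg (b - a)]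

theorem isC11Contraction_softTruncation (hk : 0 ≤ k) (hh : 0 < h) :
    IsC11Contraction (softTruncation k h) (softTruncationDeriv k h) (1 / (2 * h)) where
  map_zero := by
    rw [softTruncation, max_eq_right (by linarith), max_eq_right (by linarith)]; simp
  abs_deriv_le t := abs_le.2 ⟨by linarith [softTruncationDeriv_nonneg (k := k) hh t],
    softTruncationDeriv_le_one hh t⟩
  continuous_deriv := by unfold softTruncationDeriv; fun_prop
  taylor a b := by
    have h1 := posPart_sq_taylor (a - k) (b - k)
    have h2 := posPart_sq_taylor (a - k - h) (b - k - h)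
    have e : softTruncation k h b - softTruncation k h a - softTruncationDeriv k h a * (b - a)
        = ((max (b - k) 0 ^ 2 - max (a - k) 0 ^ 2 - 2 * max (a - k) 0 * ((b - k) - (a - k)))
          - (max (b - k - h) 0 ^ 2 - max (a - k - h) 0 ^ 2
            - 2 * max (a - k - h) 0 * ((b - k - h) - (a - k - h)))) / (2 * h) := by
      rw [softTruncation, softTruncation, softTruncationDeriv]; field_simp; ring
    rw [e, abs_div, abs_of_pos (show 0 < 2 * h by positivity), one_div, inv_mul_eq_div]
    refine div_le_div_of_nonneg_right (abs_le.2 ⟨?_, ?_⟩) (by positivity)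
    · have e2 : (b - k - h - (a - k - h)) ^ 2 = (b - a) ^ 2 := by ring
      linarith [h1.1, h2.2]
    · have e2 : (b - k - (a - k)) ^ 2 = (b - a) ^ 2 := by ring
      linarith [h1.2, h2.1]

theorem softTruncation_eq_zero (hh : 0 < h) {t : ℝ} (ht : t ≤ k) : softTruncation k h t = 0 := by
  rw [softTruncation, max_eq_right (by linarith), max_eq_right (by linarith)]; simp

theorem softTruncation_nonneg (hh : 0 < h) (t : ℝ) : 0 ≤ softTruncation k h t := by
  refine div_nonneg (sub_nonneg.2 (pow_le_pow_left₀ (le_max_right _ _)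
    (max_le_max_right 0 ?_) 2)) (by positivity)
  linarith

theorem le_softTruncation_add (hh : 0 < h) (t : ℝ) : t ≤ softTruncation k h t + k + h := by
  rw [softTruncation, ← sub_le_iff_le_add, ← sub_le_iff_le_add, le_div_iff₀ (by positivity)]
  rcases max_cases (t - k) 0 with h1 | h1 <;> rcases max_cases (t - k - h) 0 with h2 | h2 <;>
    rw [h1.1, h2.1] <;> nlinarith

end SoftTruncation

/-- De Giorgi's iteration: a function whose superlevel sets have measures `a k` with
`h a(k + 2h) ≤ M (k + h) a(k)^{1+θ}` is bounded above. -/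
theorem exists_eq_zero_of_superlevel_decay {a : ℝ → ℝ} (ha0 : ∀ k, 0 ≤ a k) (hanti : Antitone a)
    (hlim : ∀ η : ℝ, 0 < η → ∃ K : ℝ, 1 ≤ K ∧ a K ≤ η) {M θ η₀ : ℝ} (hM : 0 ≤ M) (hθ : 0 < θ)
    (hη₀ : 0 < η₀)
    (hstep : ∀ k h : ℝ, 0 ≤ k → 0 < h → a k ≤ η₀ →
      h * a (k + 2 * h) ≤ M * (k + h) * a k ^ (1 + θ)) :
    ∃ B, a B = 0 := by
  set r : ℝ := (1 / 2 : ℝ) ^ θ⁻¹ with hr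
  have hr0 : 0 < r := Real.rpow_pos_of_pos (by norm_num) _
  have hr1 : r < 1 := Real.rpow_lt_one (by norm_num) (by norm_num) (inv_pos.2 hθ)
  have hrθ : r ^ θ = 1 / 2 := Real.rpow_inv_rpow (by norm_num) hθ.ne'
  set η : ℝ := min η₀ ((r / (8 * M + 1)) ^ θ⁻¹) with hη
  have hq : 0 < r / (8 * M + 1) := by positivity
  obtain ⟨K, hK1, hKη⟩ := hlim η (lt_min hη₀ (Real.rpow_pos_of_pos hq _))
  have hKθ : 8 * M * a K ^ θ ≤ r := by
    have h1 : a K ^ θ ≤ r / (8 * M + 1) := by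
      calc _ ≤ ((r / (8 * M + 1)) ^ θ⁻¹) ^ θ :=
            Real.rpow_le_rpow (ha0 K) (hKη.trans (min_le_right _ _)) hθ.le
        _ = _ := Real.rpow_inv_rpow hq.le hθ.ne'
    calc _ ≤ (8 * M + 1) * (r / (8 * M + 1)) := by
          refine mul_le_mul (by linarith) h1 (Real.rpow_nonneg (ha0 K) _) (by positivity)
      _ = r := by field_simp
  -- the levels `K (2 - 2⁻ʲ)` increase to `2 K`
  set lev : ℕ → ℝ := fun j => K * (2 - (1 / 2) ^ j) with hlev
  have hp : ∀ j : ℕ, (0 : ℝ) < (1 / 2) ^ j ∧ ((1 : ℝ) / 2) ^ j ≤ 1 := fun j =>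
    ⟨by positivity, pow_le_one₀ (by norm_num) (by norm_num)⟩
  have hlevK : ∀ j, K ≤ lev j := fun j => by
    have := hp j; simp only [hlev]; nlinarith
  have hdecay : ∀ j, a (lev j) ≤ a K * r ^ j := by
    intro j
    induction j with
    | zero => simp only [hlev, pow_zero, mul_one]; norm_num
    | succ j ih =>
      obtain ⟨p0, p1⟩ := hp j
      set p : ℝ := (1 / 2) ^ j with hpj
      have hh : 0 < K * p / 4 := by positivity
      have hs := hstep (lev j) (K * p / 4) (by linarith [hlevK j]) hh
        ((hanti (hlevK j)).trans (hKη.trans (min_le_left _ _)))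
      have e1 : lev j + 2 * (K * p / 4) = lev (j + 1) := by
        simp only [hlev, pow_succ, ← hpj]; ring
      rw [e1] at hs
      have e2 : lev j + K * p / 4 ≤ 2 * K := by simp only [hlev, ← hpj]; nlinarith
      have e3 : a (lev j) ^ (1 + θ) ≤ (a K * r ^ j) * (a K ^ θ * p) := by
        calc _ ≤ (a K * r ^ j) ^ (1 + θ) := Real.rpow_le_rpow (ha0 _) ih (by linarith)
          _ = _ := by
            have hx : 0 ≤ a K * r ^ j := mul_nonneg (ha0 K) (by positivity)
            rw [Real.rpow_add_of_nonneg hx zero_le_one hθ.le, Real.rpow_one,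
              Real.mul_rpow (ha0 K) (by positivity), ← Real.rpow_natCast, ← Real.rpow_mul hr0.le,
              mul_comm (j : ℝ) θ, Real.rpow_mul hr0.le, hrθ, Real.rpow_natCast, Real.rpow_natCast]
      have h4 : K * p / 4 * a (lev (j + 1)) ≤ K * p / 4 * (a K * r ^ (j + 1)) := by
        calc _ ≤ M * (lev j + K * p / 4) * a (lev j) ^ (1 + θ) := hs
          _ ≤ M * (2 * K) * ((a K * r ^ j) * (a K ^ θ * p)) := by
            refine mul_le_mul (mul_le_mul_of_nonneg_left e2 hM) e3
              (Real.rpow_nonneg (ha0 _) _) (by positivity)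
          _ = K * p / 4 * (a K * r ^ j) * (8 * M * a K ^ θ) := by ring
          _ ≤ K * p / 4 * (a K * r ^ j) * r := by
            refine mul_le_mul_of_nonneg_left hKθ (mul_nonneg hh.le (mul_nonneg (ha0 K) ?_))
            positivity
          _ = _ := by ring
      exact le_of_mul_le_mul_left h4 hh
  refine ⟨2 * K, le_antisymm ?_ (ha0 _)⟩
  have hlim2 : Tendsto (fun j : ℕ => a K * r ^ j) atTop (𝓝 0) := by
    simpa using (tendsto_pow_atTop_nhds_zero_of_lt_one hr0.le hr1).const_mul (a K)
  refine ge_of_tendsto' hlim2 fun j => (hanti ?_).trans (hdecay j)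
  have := hp j; simp only [hlev]; nlinarith

section

variable {N : ℕ} {Ω : Set (EuclideanSpace ℝ (Fin N))}

/-- The step of De Giorgi's iteration: the eigenvalue equation is tested with a truncation of the
eigenfunction at the level `k`. -/
theorem HasNeumannLaplacian.mul_superlevel_le (hΩ : IsOpen Ω) (hfin : volume Ω < ⊤)
    {C θ : ℝ} (hC : 0 < C) (hθ : 0 < θ)
    (hS : HasSmallSetBound Ω C θ)
    {f : L2 Ω} {lam : ℝ} (hlam : 0 ≤ lam) (hf : HasNeumannLaplacian f (lam • f))
    {k h : ℝ} (hk : 0 ≤ k) (hh : 0 < h)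
    (hsmall : (1 + lam) * C * (volume.restrict Ω).real {x | k < f x} ^ θ ≤ 1 / 2) :
    h * (volume.restrict Ω).real {x | k + 2 * h < f x} ≤
      2 * lam * C * (k + h) * (volume.restrict Ω).real {x | k < f x} ^ (1 + θ) := by
  obtain ⟨F, hF, hFeq⟩ := hf
  have : IsFiniteMeasure (volume.restrict Ω) := ⟨by simpa using hfin⟩
  obtain ⟨u, U, hu, hu1, hU1⟩ := hF.exists_comp hΩ (isC11Contraction_softTruncation hk hh)
  have hu2 := (Lp.memLp u).integrable_sq
  have hui : Integrable u (volume.restrict Ω) := (Lp.memLp u).integrable (by norm_num)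
  have hU2 := integrable_norm_sq_of_memLp_two (Lp.memLp U)
  set a := (volume.restrict Ω).real {x | k < f x} with ha
  have ha0 : 0 ≤ a := measureReal_nonneg
  set X := ∫ x in Ω, u x ^ 2
  set Y := ∫ x in Ω, ‖U x‖ ^ 2
  set m := ∫ x in Ω, u x
  have hunn : 0 ≤ᵐ[volume.restrict Ω] u := by
    filter_upwards [hu1] with x hx
    rw [hx]; exact softTruncation_nonneg hh _
  have hX0 : 0 ≤ X := integral_nonneg fun x => sq_nonneg _
  have hY0 : 0 ≤ Y := integral_nonneg fun x => sq_nonneg _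
  have hm0 : 0 ≤ m := integral_nonneg_of_ae hunn
  -- the equation
  have hYle : Y ≤ lam * ∫ x in Ω, f x * u x := by
    have h1 : Y ≤ ∫ x in Ω, ⟪F x, U x⟫_ℝ := by
      refine integral_mono_ae hU2
        (integrable_inner_of_memLp_two (Lp.memLp F) (Lp.memLp U)) ?_
      filter_upwards [hU1] with x hx
      have d0 := softTruncationDeriv_nonneg (k := k) hh (f x)
      have d1 := softTruncationDeriv_le_one (k := k) hh (f x)
      rw [hx, norm_smul, real_inner_smul_right, real_inner_self_eq_norm_sq, mul_pow,
        Real.norm_eq_abs, sq_abs]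
      refine mul_le_mul_of_nonneg_right ?_ (sq_nonneg _)
      nlinarith
    rw [hFeq u U hu] at h1
    refine h1.trans_eq ?_
    rw [← inner_Lp_eq_integral, ← inner_Lp_eq_integral, real_inner_smul_left]
  have hfu : ∫ x in Ω, f x * u x ≤ X + (k + h) * m := by
    rw [← integral_const_mul, ← integral_add hu2 (hui.const_mul _)]
    refine integral_mono_ae (integrable_mul_of_memLp_two (Lp.memLp f) (Lp.memLp u))
      (hu2.add (hui.const_mul _)) ?_
    filter_upwards [hu1, hunn] with x hx h0
    have h1 := le_softTruncation_add (k := k) hh (f x)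
    rw [← hx] at h1
    simp only [Pi.zero_apply] at h0
    nlinarith
  -- the Sobolev inequality on the superlevel set
  have hAm : MeasurableSet {x | k < f x} :=
    measurableSet_lt measurable_const (Lp.stronglyMeasurable f).measurable
  set A := {x | k < f x} ∩ Ω with hA
  have hAm' : MeasurableSet A := hAm.inter hΩ.measurableSet
  have haA : volume.real A = a := by rw [ha, measureReal_restrict_apply hAm]
  have hzero : ∀ᵐ x ∂volume, x ∈ Ω \ A → u x = 0 := by
    filter_upwards [(ae_restrict_iff' hΩ.measurableSet).1 hu1] with x hx hxA
    rw [hx hxA.1]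
    exact softTruncation_eq_zero hh (not_lt.1 fun h => hxA.2 ⟨h, hxA.1⟩)
  have hXA : X = ∫ x in A, u x ^ 2 := by
    refine setIntegral_eq_of_subset_of_ae_sdiff_eq_zero hΩ.measurableSet.nullMeasurableSet
      inter_subset_right ?_
    filter_upwards [hzero] with x hx hxA
    rw [hx hxA]; simp
  have hmA : m = ∫ x in A, u x := setIntegral_eq_of_subset_of_ae_sdiff_eq_zero
    hΩ.measurableSet.nullMeasurableSet inter_subset_right hzero
  have hXle : X ≤ C * a ^ θ * (X + Y) := by
    have := hS u U hu A inter_subset_right hAm'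
    rwa [← hXA, haA] at this
  have hmX : m ^ 2 ≤ a * X := by
    have hA' : volume.restrict A ≤ volume.restrict Ω :=
      Measure.restrict_mono_set _ inter_subset_right
    have : IsFiniteMeasure (volume.restrict A) := ⟨(hA' univ).trans_lt (measure_lt_top _ _)⟩
    have h1 := sq_integral_mul_le (μ := volume.restrict A) (memLp_const (1 : ℝ))
      ((Lp.memLp u).mono_measure hA')
    rw [← hXA] at h1
    simp only [one_mul, one_pow, integral_const, measureReal_restrict_apply_univ, smul_eq_mul,
      mul_one] at h1
    rwa [haA, ← hmA] at h1
  have haθ : 0 ≤ a ^ θ := Real.rpow_nonneg ha0 _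
  have hE : X + Y ≤ 2 * lam * (k + h) * m := by
    have h1 : X + Y ≤ (1 + lam) * X + lam * (k + h) * m := by nlinarith
    have h2 : (1 + lam) * X ≤ 1 / 2 * (X + Y) := by
      calc _ ≤ (1 + lam) * (C * a ^ θ * (X + Y)) := by gcongr
        _ = (1 + lam) * C * a ^ θ * (X + Y) := by ring
        _ ≤ _ := by gcongr
    linarith
  have hm : m ≤ 2 * lam * C * (k + h) * a ^ (1 + θ) := by
    rw [Real.rpow_add_of_nonneg ha0 zero_le_one hθ.le, Real.rpow_one]
    rcases hm0.eq_or_lt with h0 | h0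
    · rw [← h0]; positivity
    · refine le_of_mul_le_mul_left ?_ h0
      calc m * m = m ^ 2 := by ring
        _ ≤ a * X := hmX
        _ ≤ a * (C * a ^ θ * (2 * lam * (k + h) * m)) := by
            gcongr; exact hXle.trans (by gcongr)
        _ = _ := by ring
  refine le_trans ?_ hm
  refine le_trans ?_ (mul_meas_ge_le_integral_of_nonneg hunn hui h)
  refine mul_le_mul_of_nonneg_left ?_ hh.le
  refine ENNReal.toReal_mono (measure_ne_top _ _) (measure_mono_ae ?_)
  filter_upwards [hu1] with x hx hxk
  have h1 := le_softTruncation_add (k := k) hh (f x)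
  rw [← hx] at h1
  have hxk' : k + 2 * h < f x := hxk
  show h ≤ u x
  linarith

theorem HasNeumannLaplacian.exists_ae_le (hΩ : IsOpen Ω) (hfin : volume Ω < ⊤)
    {C θ : ℝ} (hC : 0 < C) (hθ : 0 < θ)
    (hS : HasSmallSetBound Ω C θ)
    {f : L2 Ω} {lam : ℝ} (hlam : 0 ≤ lam) (hf : HasNeumannLaplacian f (lam • f)) :
    ∃ B : ℝ, ∀ᵐ x ∂volume.restrict Ω, f x ≤ B := by
  have : IsFiniteMeasure (volume.restrict Ω) := ⟨by simpa using hfin⟩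
  set a : ℝ → ℝ := fun k => (volume.restrict Ω).real {x | k < f x} with ha
  have hq : 0 < 1 / (2 * ((1 + lam) * C)) := by positivity
  obtain ⟨B, hB⟩ := exists_eq_zero_of_superlevel_decay (a := a) (fun k => measureReal_nonneg)
    (fun k l hkl => measureReal_mono fun x hx => lt_of_le_of_lt hkl hx)
    (fun η hη => by
      set I := ∫ x in Ω, f x ^ 2
      have hI0 : 0 ≤ I := integral_nonneg fun x => sq_nonneg _
      refine ⟨max 1 (I / η), le_max_left _ _, ?_⟩
      set K := max 1 (I / η)
      have hK1 : 1 ≤ K := le_max_left _ _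
      have h1 := mul_meas_ge_le_integral_of_nonneg
        (Eventually.of_forall fun x => sq_nonneg (f x)) (Lp.memLp f).integrable_sq (K ^ 2)
      have h2 : a K ≤ (volume.restrict Ω).real {x | K ^ 2 ≤ f x ^ 2} :=
        measureReal_mono fun x hx => pow_le_pow_left₀ (zero_le_one.trans hK1) (le_of_lt hx) 2
      have h3 : I ≤ K * η := by
        rw [← div_le_iff₀ hη]; exact le_max_right _ _
      have ha0 : 0 ≤ a K := measureReal_nonneg
      have h4 : K ^ 2 * a K ≤ K * η := by
        calc _ ≤ K ^ 2 * (volume.restrict Ω).real {x | K ^ 2 ≤ f x ^ 2} := by gcongr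
          _ ≤ _ := h1.trans h3
      have h5 : K * a K ≤ η := by
        refine le_of_mul_le_mul_left ?_ (zero_lt_one.trans_le hK1)
        rwa [← mul_assoc, ← sq]
      exact (le_mul_of_one_le_left ha0 hK1).trans h5)
    (M := 2 * lam * C) (θ := θ) (η₀ := (1 / (2 * ((1 + lam) * C))) ^ θ⁻¹) (by positivity) hθ
    (Real.rpow_pos_of_pos hq _)
    (fun k h hk hh hkη => by
      refine HasNeumannLaplacian.mul_superlevel_le hΩ hfin hC hθ hS hlam hf hk hh ?_
      have h1 : a k ^ θ ≤ 1 / (2 * ((1 + lam) * C)) := by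
        calc _ ≤ ((1 / (2 * ((1 + lam) * C))) ^ θ⁻¹) ^ θ :=
              Real.rpow_le_rpow measureReal_nonneg hkη hθ.le
          _ = _ := Real.rpow_inv_rpow hq.le hθ.ne'
      calc _ ≤ (1 + lam) * C * (1 / (2 * ((1 + lam) * C))) := by gcongr
        _ = 1 / 2 := by field_simp)
  refine ⟨B, ?_⟩
  rw [ae_iff]
  simpa [ha, measureReal_eq_zero_iff] using hB

theorem HasNeumannLaplacian.neg {f h : L2 Ω} (hf : HasNeumannLaplacian f h) :
    HasNeumannLaplacian (-f) (-h) := by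
  obtain ⟨F, hF, hFeq⟩ := hf
  have hw : (WithLp.toLp 2 (f, F)) ∈ weakGradientGraph Ω := hF
  refine ⟨-F, (weakGradientGraph Ω).neg_mem hw, fun g G hg => ?_⟩
  have := hFeq g G hg
  rw [← L2.inner_def, ← inner_Lp_eq_integral] at this ⊢
  rw [inner_neg_left, inner_neg_left, this]

/-- Eigenfunctions are bounded. -/
theorem HasNeumannLaplacian.exists_ae_abs_le (hΩ : IsOpen Ω) (hfin : volume Ω < ⊤)
    {C θ : ℝ} (hC : 0 < C) (hθ : 0 < θ)
    (hS : HasSmallSetBound Ω C θ)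
    {f : L2 Ω} {lam : ℝ} (hlam : 0 ≤ lam) (hf : HasNeumannLaplacian f (lam • f)) :
    ∃ B : ℝ, ∀ᵐ x ∂volume.restrict Ω, |f x| ≤ B := by
  obtain ⟨B₁, h1⟩ := HasNeumannLaplacian.exists_ae_le hΩ hfin hC hθ hS hlam hf
  have hf' := hf.neg
  rw [← smul_neg] at hf'
  obtain ⟨B₂, h2⟩ := HasNeumannLaplacian.exists_ae_le hΩ hfin hC hθ hS hlam hf'
  refine ⟨max B₁ B₂, ?_⟩
  filter_upwards [h1, h2, Lp.coeFn_neg f] with x a1 a2 a3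
  rw [a3, Pi.neg_apply] at a2
  exact abs_le.2 ⟨by linarith [le_max_right B₁ B₂], a1.trans (le_max_left _ _)⟩

end

/-! ### Eigenfunctions as test functions on a smaller region -/

section

variable {N : ℕ} {Ω Ω₁ Ω₂ : Set (EuclideanSpace ℝ (Fin N))}

/-- Restriction of square integrable functions to a smaller set. -/
noncomputable def restrictL2 (h : Ω₂ ⊆ Ω₁) : L2 Ω₁ →ₗ[ℝ] L2 Ω₂ where
  toFun f := ((Lp.memLp f).mono_measure (Measure.restrict_mono_set _ h)).toLp
  map_add' f g := by
    have hac : volume.restrict Ω₂ ≪ volume.restrict Ω₁ :=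
      (Measure.restrict_mono_set _ h).absolutelyContinuous
    rw [← MemLp.toLp_add]
    exact (MemLp.toLp_eq_toLp_iff _ _).2 (hac.ae_eq (Lp.coeFn_add f g))
  map_smul' c f := by
    have hac : volume.restrict Ω₂ ≪ volume.restrict Ω₁ :=
      (Measure.restrict_mono_set _ h).absolutelyContinuous
    rw [RingHom.id_apply, ← MemLp.toLp_const_smul]
    exact (MemLp.toLp_eq_toLp_iff _ _).2 (hac.ae_eq (Lp.coeFn_smul c f))

theorem coeFn_restrictL2 (h : Ω₂ ⊆ Ω₁) (f : L2 Ω₁) :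
    restrictL2 h f =ᵐ[volume.restrict Ω₂] f :=
  ((Lp.memLp f).mono_measure (Measure.restrict_mono_set _ h)).coeFn_toLp

theorem integral_restrictL2_sq (h : Ω₂ ⊆ Ω₁) (f : L2 Ω₁) :
    ∫ x in Ω₂, restrictL2 h f x ^ 2 = ∫ x in Ω₂, f x ^ 2 := by
  refine integral_congr_ae ?_
  filter_upwards [coeFn_restrictL2 h f] with x hx
  rw [hx]

theorem IsWeakGradient.restrict (h : Ω₂ ⊆ Ω₁) {f : L2 Ω₁} {F : L2Field Ω₁}
    (hF : IsWeakGradient f F) : IsWeakGradient (restrictL2 h f)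
      ((((Lp.memLp F).mono_measure (Measure.restrict_mono_set _ h)).toLp) : L2Field Ω₂) := by
  intro φ hφ v
  have hφ1 : IsTestFunction Ω₁ φ := ⟨hφ.1, hφ.2.1, hφ.2.2.trans h⟩
  have key := hF φ hφ1 v
  have z1 : ∀ x ∉ tsupport φ, φ x = 0 := fun x hx => image_eq_zero_of_notMem_tsupport hx
  have z2 : ∀ x ∉ tsupport φ, fderiv ℝ φ x v = 0 := fun x hx => by
    rw [fderiv_eq_zero_of_notMem_tsupport hx]; rfl
  have e1 : ∫ x in Ω₂, restrictL2 h f x * fderiv ℝ φ x v = ∫ x in Ω₂, f x * fderiv ℝ φ x v := by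
    refine integral_congr_ae ?_
    filter_upwards [coeFn_restrictL2 h f] with x hx
    rw [hx]
  have e2 : ∫ x in Ω₂, ⟪(((Lp.memLp F).mono_measure (Measure.restrict_mono_set _ h)).toLp :
      L2Field Ω₂) x, v⟫_ℝ * φ x = ∫ x in Ω₂, ⟪F x, v⟫_ℝ * φ x := by
    refine integral_congr_ae ?_
    filter_upwards [((Lp.memLp F).mono_measure (Measure.restrict_mono_set _ h)).coeFn_toLp]
      with x hx
    rw [hx]
  rw [setIntegral_eq_integral_of_forall_compl_eq_zero fun x hx => by
      rw [z2 x (fun h => hx (hφ1.2.2 h)), mul_zero],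
    setIntegral_eq_integral_of_forall_compl_eq_zero fun x hx => by
      rw [z1 x (fun h => hx (hφ1.2.2 h)), mul_zero]] at key
  rw [e1, e2, setIntegral_eq_integral_of_forall_compl_eq_zero fun x hx => by
      rw [z2 x (fun h => hx (hφ.2.2 h)), mul_zero],
    setIntegral_eq_integral_of_forall_compl_eq_zero fun x hx => by
      rw [z1 x (fun h => hx (hφ.2.2 h)), mul_zero], key]

theorem Qform_restrictL2_le (h : Ω₂ ⊆ Ω₁) {f : L2 Ω₁} {F : L2Field Ω₁}
    (hF : IsWeakGradient f F) :
    Qform (restrictL2 h f) ≤ ENNReal.ofReal (∫ x in Ω₁, ‖F x‖ ^ 2) := by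
  refine (iInf₂_le _ (hF.restrict h)).trans ?_
  rw [← lintegral_enorm_sq_eq (Lp.memLp F)]
  refine le_trans (le_of_eq (lintegral_congr_ae ?_)) (lintegral_mono_set h)
  filter_upwards [((Lp.memLp F).mono_measure (Measure.restrict_mono_set _ h)).coeFn_toLp]
    with x hx
  rw [hx]

theorem Lp_coeFn_sum {ι : Type*} (s : Finset ι) (w : ι → L2 Ω) :
    (∑ i ∈ s, w i : L2 Ω) =ᵐ[volume.restrict Ω] fun x => ∑ i ∈ s, w i x := by
  classical
  induction s using Finset.induction_on with
  | empty =>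
    simp only [Finset.sum_empty]
    exact Lp.coeFn_zero _ _ _
  | insert i s hi ih =>
    rw [Finset.sum_insert hi]
    filter_upwards [Lp.coeFn_add (w i) (∑ i ∈ s, w i), ih] with x h1 h2
    rw [h1, Pi.add_apply, h2, Finset.sum_insert hi]

theorem ae_sum_smul_sq_le {ι : Type*} [Fintype ι] {v : ι → L2 Ω} {B : ℝ}
    (hB : ∀ i, ∀ᵐ x ∂volume.restrict Ω, |v i x| ≤ B) (c : ι → ℝ) :
    ∀ᵐ x ∂volume.restrict Ω,
      (∑ i, c i • v i : L2 Ω) x ^ 2 ≤ Fintype.card ι * B ^ 2 * ∑ i, c i ^ 2 := by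
  have h1 : ∀ᵐ x ∂volume.restrict Ω, ∀ i, |v i x| ≤ B := ae_all_iff.2 hB
  have h2 : ∀ᵐ x ∂volume.restrict Ω, ∀ i, (c i • v i : L2 Ω) x = c i * v i x :=
    ae_all_iff.2 fun i => by
      filter_upwards [Lp.coeFn_smul (c i) (v i)] with x hx
      rw [hx]; rfl
  filter_upwards [h1, h2, Lp_coeFn_sum Finset.univ fun i => c i • v i] with x a1 a2 a3
  rw [a3]
  simp only [a2]
  refine (Finset.sum_mul_sq_le_sq_mul_sq _ _ _).trans ?_
  rw [mul_comm]
  refine mul_le_mul_of_nonneg_right ?_ (Finset.sum_nonneg fun i _ => sq_nonneg _)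
  calc ∑ i, v i x ^ 2 ≤ ∑ _i : ι, B ^ 2 := Finset.sum_le_sum fun i _ => by
        rw [← sq_abs]; exact pow_le_pow_left₀ (abs_nonneg _) (a1 i) 2
    _ = _ := by simp

theorem HasNeumannLaplacian.eigenvalue_nonneg {f : L2 Ω} {lam : ℝ}
    (hf : HasNeumannLaplacian f (lam • f)) (h1 : ‖f‖ = 1) : 0 ≤ lam := by
  obtain ⟨F, hF, hFeq⟩ := hf
  have := hFeq f F hF
  rw [← inner_Lp_eq_integral, real_inner_smul_left, real_inner_self_eq_norm_sq, h1] at this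
  have h0 : 0 ≤ ∫ x in Ω, ⟪F x, F x⟫_ℝ := integral_nonneg fun x => real_inner_self_nonneg
  linarith

/-- A linear combination of the first eigenfunctions has a weak gradient, with energy controlled
by the last eigenvalue. -/
theorem exists_isWeakGradient_sum_integral_le {lam : ℕ → ℝ} (hlam : Monotone lam)
    {φ : ℕ → L2 Ω} (hφ : Orthonormal ℝ φ) (hφe : ∀ n, HasNeumannLaplacian (φ n) (lam n • φ n))
    (n : ℕ) (c : Fin (n + 1) → ℝ) :
    ∃ F : L2Field Ω, IsWeakGradient (∑ i, c i • φ i : L2 Ω) F ∧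
      ∫ x in Ω, ‖F x‖ ^ 2 ≤ lam n * ∑ i, c i ^ 2 := by
  choose G hG hGe using hφe
  have hmem : (∑ i : Fin (n + 1), c i • WithLp.toLp 2 (φ i, G i)) ∈ weakGradientGraph Ω :=
    Submodule.sum_mem _ fun i _ => Submodule.smul_mem _ _ (hG i)
  have e : (∑ i : Fin (n + 1), c i • WithLp.toLp 2 (φ i, G i))
      = WithLp.toLp 2 ((∑ i : Fin (n + 1), c i • φ i : L2 Ω),
        (∑ i : Fin (n + 1), c i • G i : L2Field Ω)) := by
    refine WithLp.ofLp_injective 2 (Prod.ext ?_ ?_)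
    · have := map_sum (WithLp.fstL 2 ℝ (L2 Ω) (L2Field Ω))
        (fun i : Fin (n + 1) => c i • WithLp.toLp 2 (φ i, G i)) Finset.univ
      exact this
    · have := map_sum (WithLp.sndL 2 ℝ (L2 Ω) (L2Field Ω))
        (fun i : Fin (n + 1) => c i • WithLp.toLp 2 (φ i, G i)) Finset.univ
      exact this
  rw [e] at hmem
  have hw : IsWeakGradient (∑ i : Fin (n + 1), c i • φ i : L2 Ω)
      (∑ i : Fin (n + 1), c i • G i : L2Field Ω) := hmem
  refine ⟨_, hw, ?_⟩
  set F : L2Field Ω := ∑ i : Fin (n + 1), c i • G i with hF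
  have hφ' : Orthonormal ℝ fun i : Fin (n + 1) => φ i := hφ.comp _ Fin.val_injective
  have h1 : ∀ i : Fin (n + 1), ⟪G i, F⟫_ℝ = lam i * c i := by
    intro i
    have := hGe i _ _ hw
    rw [← L2.inner_def, ← inner_Lp_eq_integral, real_inner_smul_left,
      hφ'.inner_right_fintype] at this
    exact this
  rw [← norm_L2Field_sq_eq_integral, ← real_inner_self_eq_norm_sq]
  nth_rewrite 1 [hF]
  rw [sum_inner, Finset.mul_sum]
  refine Finset.sum_le_sum fun i _ => ?_
  rw [real_inner_smul_left, h1]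
  have : lam i ≤ lam n := hlam (Nat.lt_succ_iff.1 i.2)
  nlinarith [mul_le_mul_of_nonneg_right this (sq_nonneg (c i))]

/-- Restricting the span of the first `n + 1` eigenfunctions of `Ω₁` to `Ω₂` gives a test space for
`μ_n(Ω₂)`; the eigenfunctions being bounded, norms drop only by a factor `1 - O(|Ω₁ \ Ω₂|)`. -/
theorem variationalEigenvalue_le_of_ae_abs_le (h2 : IsOpen Ω₂) (h : Ω₂ ⊆ Ω₁)
    (hfin : volume Ω₁ < ⊤)
    {lam : ℕ → ℝ} (hlam : Monotone lam) {φ : ℕ → L2 Ω₁} (hφ : Orthonormal ℝ φ)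
    (hφe : ∀ n, HasNeumannLaplacian (φ n) (lam n • φ n)) (n : ℕ) {B D : ℝ}
    (hB : ∀ i ≤ n, ∀ᵐ x ∂volume.restrict Ω₁, |φ i x| ≤ B) (hD : (n + 1) * B ^ 2 ≤ D)
    (hsmall : D * volume.real (Ω₁ \ Ω₂) ≤ 1 / 2) :
    variationalEigenvalue Ω₂ n ≤
      ENNReal.ofReal ((1 + 2 * D * volume.real (Ω₁ \ Ω₂)) * lam n) := by
  have hlam0 : 0 ≤ lam n := (hφe n).eigenvalue_nonneg (hφ.1 n)
  have hφ' : Orthonormal ℝ fun i : Fin (n + 1) => φ i := hφ.comp _ Fin.val_injective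
  set t := volume.real (Ω₁ \ Ω₂) with ht
  have ht0 : 0 ≤ t := measureReal_nonneg
  have hD0 : 0 ≤ D := le_trans (by positivity) hD
  have hf : ∀ c : Fin (n + 1) → ℝ,
      (1 - D * t) * ∑ i, c i ^ 2 ≤ ∫ x in Ω₂, (∑ i, c i • φ i : L2 Ω₁) x ^ 2 := by
    intro c
    set f : L2 Ω₁ := ∑ i, c i • φ i with hfdef
    set S := ∑ i, c i ^ 2 with hS
    have hS0 : 0 ≤ S := Finset.sum_nonneg fun i _ => sq_nonneg _
    have hn : ∫ x in Ω₁, f x ^ 2 = S := by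
      rw [← norm_Lp_sq_eq_integral, ← real_inner_self_eq_norm_sq, hfdef, hφ'.inner_sum]
      simp [hS, sq]
    have hsplit := setIntegral_sdiff h2.measurableSet (f := fun x => f x ^ 2)
      (Lp.memLp f).integrable_sq h
    have hA : ∫ x in Ω₁ \ Ω₂, f x ^ 2 ≤ D * S * t := by
      have hae := ae_sum_smul_sq_le (v := fun i : Fin (n + 1) => φ i)
        (fun i => hB i (Nat.lt_succ_iff.1 i.2)) c
      have hae' : ∀ᵐ x ∂volume.restrict (Ω₁ \ Ω₂), f x ^ 2 ≤ D * S := by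
        filter_upwards [ae_restrict_of_ae_restrict_of_subset sdiff_subset hae] with x hx
        refine hx.trans ?_
        rw [Fintype.card_fin]; push_cast
        exact mul_le_mul_of_nonneg_right hD hS0
      have hlt : volume (Ω₁ \ Ω₂) < ⊤ := (measure_mono sdiff_subset).trans_lt hfin
      have : IsFiniteMeasure (volume.restrict (Ω₁ \ Ω₂)) := ⟨by simpa using hlt⟩
      calc _ ≤ ∫ x in Ω₁ \ Ω₂, D * S :=
            integral_mono_ae ((Lp.memLp f).mono_measure
              (Measure.restrict_mono_set _ sdiff_subset)).integrable_sq (integrable_const _) hae'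
        _ = _ := by rw [setIntegral_const, smul_eq_mul, mul_comm]
    linarith
  set Φ : (Fin (n + 1) → ℝ) →ₗ[ℝ] L2 Ω₂ :=
    restrictL2 h ∘ₗ Fintype.linearCombination ℝ (fun i : Fin (n + 1) => φ i) with hΦ
  have hΦa : ∀ c, Φ c = restrictL2 h (∑ i, c i • φ i) := fun c => by
    simp [hΦ, Fintype.linearCombination_apply]
  have hinj : Function.Injective Φ := by
    rw [injective_iff_map_eq_zero]
    intro c hc
    have h3 := hf c
    rw [← integral_restrictL2_sq h, ← hΦa, hc, ← norm_Lp_sq_eq_integral, norm_zero] at h3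
    have h4 : ∑ i, c i ^ 2 ≤ 0 := by nlinarith
    ext i
    have h5 := (Finset.single_le_sum (f := fun i => c i ^ 2) (fun i _ => sq_nonneg _)
      (Finset.mem_univ i)).trans h4
    exact pow_eq_zero_iff (two_ne_zero) |>.1 (le_antisymm h5 (sq_nonneg _))
  refine (iInf₂_le (LinearMap.range Φ) ?_).trans ?_
  · rw [LinearMap.finrank_range_of_inj hinj]; simp
  · refine iSup_le fun u => iSup₂_le fun hu _ => ?_
    obtain ⟨c, rfl⟩ := hu
    obtain ⟨F, hF, hFle⟩ := exists_isWeakGradient_sum_integral_le hlam hφ hφe n c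
    have hS0 : 0 ≤ ∑ i, c i ^ 2 := Finset.sum_nonneg fun i _ => sq_nonneg _
    refine ENNReal.div_le_of_le_mul ?_
    rw [hΦa, enorm_sq_Lp_eq, integral_restrictL2_sq, ← ENNReal.ofReal_mul (by positivity)]
    refine (Qform_restrictL2_le h hF).trans (ENNReal.ofReal_le_ofReal ?_)
    calc _ ≤ lam n * ∑ i, c i ^ 2 := hFle
      _ ≤ (1 + 2 * D * t) * (1 - D * t) * (lam n * ∑ i, c i ^ 2) := by
        refine le_mul_of_one_le_left (by positivity) ?_
        nlinarith [mul_nonneg hD0 ht0]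
      _ = (1 + 2 * D * t) * lam n * ((1 - D * t) * ∑ i, c i ^ 2) := by ring
      _ ≤ _ := mul_le_mul_of_nonneg_left (hf c) (by positivity)

end

/-! ### Boundary layers -/

section

variable {N : ℕ} {Ω : Set (EuclideanSpace ℝ (Fin N))}

theorem boundaryLayer_subset (ε : ℝ) : boundaryLayer Ω ε ⊆ Ω := fun _ hx => hx.1

theorem minkowskiContent_self_lt_top (hfin : volume Ω < ⊤) : minkowskiContent Ω N < ⊤ := by
  refine lt_of_le_of_lt ?_ hfin
  refine limsup_le_of_le (h := Eventually.of_forall fun ε => ?_)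
  rw [sub_self, Real.rpow_zero, ENNReal.ofReal_one, div_one]
  exact measure_mono (boundaryLayer_subset ε)

/-- Below the Minkowski codimension, the volume of the boundary layer decays like a power. -/
theorem exists_measureReal_boundaryLayer_le (hN : 1 ≤ N) (hfin : volume Ω < ⊤) {σ : ℝ}
    (hσ : σ < N - minkowskiDim Ω) :
    ∃ D : ℝ, 0 < D ∧ ∃ ε₀ : ℝ, 0 < ε₀ ∧ ∀ ε : ℝ, 0 < ε → ε ≤ ε₀ →
      volume.real (boundaryLayer Ω ε) ≤ D * ε ^ σ := by
  have hne : {s : ℝ | 0 < s ∧ minkowskiContent Ω s < ⊤}.Nonempty :=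
    ⟨N, by exact_mod_cast hN, minkowskiContent_self_lt_top hfin⟩
  obtain ⟨s, ⟨-, hs⟩, hsσ⟩ := exists_lt_of_csInf_lt hne (show minkowskiDim Ω < N - σ by linarith)
  obtain ⟨c, hc1, hc2⟩ := exists_between hs
  have hev := eventually_lt_of_limsup_lt hc1
  obtain ⟨δ, hδ, hδ'⟩ := (mem_nhdsGT_iff_exists_Ioo_subset).1 hev
  have hδ0 : (0 : ℝ) < δ := hδ
  refine ⟨c.toReal + 1, by positivity, min (δ / 2) 1, by positivity, fun ε hε hε' => ?_⟩
  have h1 : volume (boundaryLayer Ω ε) / ENNReal.ofReal (ε ^ ((N : ℝ) - s)) < c :=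
    hδ' ⟨hε, lt_of_le_of_lt (hε'.trans (min_le_left _ _)) (by linarith)⟩
  have hp : 0 < ε ^ ((N : ℝ) - s) := Real.rpow_pos_of_pos hε _
  have h2 : volume (boundaryLayer Ω ε) ≤ c * ENNReal.ofReal (ε ^ ((N : ℝ) - s)) :=
    (ENNReal.div_le_iff (by simpa using hp) ENNReal.ofReal_ne_top).1 h1.le
  have h3 := ENNReal.toReal_mono (ENNReal.mul_ne_top hc2.ne ENNReal.ofReal_ne_top) h2
  rw [ENNReal.toReal_mul, ENNReal.toReal_ofReal hp.le] at h3
  refine h3.trans ?_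
  refine mul_le_mul (by linarith) ?_ hp.le (by positivity)
  exact Real.rpow_le_rpow_of_exponent_ge hε (hε'.trans (min_le_right _ _)) (by linarith)

end

theorem theorem13 {N : ℕ} (hN : 1 ≤ N) (Ω₁ : Set (EuclideanSpace ℝ (Fin N)))
    (hΩ₁ : IsRegion Ω₁) (hfin : volume Ω₁ < ⊤)
    (hSob : ∃ q : ℝ≥0∞, 2 < q ∧ ∃ c : ℝ, 0 < c ∧ SobolevInequality Ω₁ q c) :
    (∃ lam : ℕ → ℝ, IsNeumannEigenvalueSequence Ω₁ lam) ∧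
    ∀ lam : ℕ → ℝ, IsNeumannEigenvalueSequence Ω₁ lam →
      (∀ n : ℕ, 1 ≤ n → ∃ b : ℝ, 0 < b ∧ ∃ ε₀ : ℝ, 0 < ε₀ ∧
        ∀ Ω₂ : Set (EuclideanSpace ℝ (Fin N)), IsRegion Ω₂ → Ω₂ ⊆ Ω₁ →
          volume.real (Ω₁ \ Ω₂) ≤ ε₀ →
          variationalEigenvalue Ω₂ n ≤
            ENNReal.ofReal ((1 + b * volume.real (Ω₁ \ Ω₂)) * lam n)) ∧
      (minkowskiDim Ω₁ < N →
        ∀ σ : ℝ, 0 < σ → σ < N - minkowskiDim Ω₁ →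
        ∀ n : ℕ, 1 ≤ n → ∃ b : ℝ, 0 < b ∧ ∃ ε₀ : ℝ, 0 < ε₀ ∧
          ∀ ε : ℝ, 0 < ε → ε ≤ ε₀ →
          ∀ Ω₂ : Set (EuclideanSpace ℝ (Fin N)), IsRegion Ω₂ →
            Ω₁ \ boundaryLayer Ω₁ ε ⊆ Ω₂ → Ω₂ ⊆ Ω₁ →
            variationalEigenvalue Ω₂ n ≤
              ENNReal.ofReal ((1 + b * ε ^ σ) * lam n)) := by
  obtain ⟨hopen, hconn⟩ := hΩ₁
  obtain ⟨q, hq, c, hc, hS⟩ := hSob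
  obtain ⟨C, θ, hC, hθ, hCθ⟩ := hS.exists_setIntegral_sq_le hopen hfin hq hc
  refine ⟨exists_isNeumannEigenvalueSequence hopen
    (not_finiteDimensional_L2 hN hopen hconn.nonempty hfin) fun ε hε =>
      exists_finset_norm_sq_le_of_inner_eq_zero hopen hfin hC hθ hCθ hε, ?_⟩
  rintro lam ⟨hmono, -, φ, hφ⟩
  have hlam0 : ∀ n, 0 ≤ lam n := fun n => (hφ n).eigenvalue_nonneg (φ.orthonormal.1 n)
  have hpart : ∀ n : ℕ, ∃ b : ℝ, 0 < b ∧ ∃ ε₀ : ℝ, 0 < ε₀ ∧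
      ∀ Ω₂ : Set (EuclideanSpace ℝ (Fin N)), IsRegion Ω₂ → Ω₂ ⊆ Ω₁ →
        volume.real (Ω₁ \ Ω₂) ≤ ε₀ → variationalEigenvalue Ω₂ n ≤
          ENNReal.ofReal ((1 + b * volume.real (Ω₁ \ Ω₂)) * lam n) := by
    intro n
    choose B hB using fun i =>
      (hφ i).exists_ae_abs_le hopen hfin hC hθ hCθ (hlam0 i)
    set B' := ∑ i ∈ Finset.range (n + 1), |B i|
    have hB' : ∀ i ≤ n, ∀ᵐ x ∂volume.restrict Ω₁, |φ i x| ≤ B' := fun i hi => by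
      filter_upwards [hB i] with x hx
      exact hx.trans ((le_abs_self _).trans (Finset.single_le_sum (f := fun i => |B i|)
        (fun _ _ => abs_nonneg _) (Finset.mem_range.2 (Nat.lt_succ_iff.2 hi))))
    set D : ℝ := (n + 1) * B' ^ 2 + 1
    have hD : 0 < D := by positivity
    refine ⟨2 * D, by positivity, 1 / (2 * D), by positivity, fun Ω₂ h2 h h3 => ?_⟩
    refine variationalEigenvalue_le_of_ae_abs_le h2.1 h hfin hmono φ.orthonormal hφ n
      hB' (by linarith) ?_
    calc _ ≤ D * (1 / (2 * D)) := by gcongr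
      _ = 1 / 2 := by field_simp
  refine ⟨fun n _ => hpart n, fun _ σ hσ0 hσ n _ => ?_⟩
  obtain ⟨b, hb, ε₁, hε₁, hmain⟩ := hpart n
  obtain ⟨D, hD, ε₂, hε₂, hlayer⟩ := exists_measureReal_boundaryLayer_le hN hfin hσ
  refine ⟨b * D, by positivity, min ε₂ ((ε₁ / D) ^ σ⁻¹),
    lt_min hε₂ (Real.rpow_pos_of_pos (by positivity) _), fun ε hε hε' Ω₂ h2 hsub h => ?_⟩
  have hvol : volume.real (Ω₁ \ Ω₂) ≤ D * ε ^ σ := by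
    refine le_trans (measureReal_mono (fun x hx => ?_)
      ((measure_mono (boundaryLayer_subset ε)).trans_lt hfin).ne)
      (hlayer ε hε (hε'.trans (min_le_left _ _)))
    by_contra hx'
    exact hx.2 (hsub ⟨hx.1, hx'⟩)
  have hεσ : D * ε ^ σ ≤ ε₁ := by
    have : ε ^ σ ≤ ε₁ / D := by
      calc _ ≤ ((ε₁ / D) ^ σ⁻¹) ^ σ :=
            Real.rpow_le_rpow hε.le (hε'.trans (min_le_right _ _)) hσ0.le
        _ = _ := Real.rpow_inv_rpow (by positivity) hσ0.ne'
    calc _ ≤ D * (ε₁ / D) := by gcongr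
      _ = ε₁ := by field_simp
  refine (hmain Ω₂ h2 h (hvol.trans hεσ)).trans (ENNReal.ofReal_le_ofReal ?_)
  refine mul_le_mul_of_nonneg_right ?_ (hlam0 n)
  rw [mul_assoc]
  gcongr
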